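/- Let $p\ge 0$ be an integer, let $(\Delta,\mu)$ be a probability space, let $T:\Delta\to\Delta$ be a measurable map for which $\mu$ is invariant and ergodic, and let $A:\Delta\to \mathrm{GL}(p,\mathbb R)$ be measurable with $$\int_\Delta \ln\|A(x)\|\,d\mu(x)<\infty,$$ meaning that the positive part of $\ln\|A\|$ is integrable, where $\|\cdot\|$ is the Euclidean norm on $\mathbb R^p$ and the induced operator norm (such a pair $(T,A)$ is called a measurable cocycle). Put $A_0(x)=I$ and $A_n(x)=A(T^{n-1}(x))\cdots A(T(x))A(x)$ for $n\ge 1$. For $x\in\Delta$ let $$E^{cs}(x)=\{w\in\mathbb R^p:\ \limsup_{n\to\infty}\|A_n(x)w\|^{1/n}\le 1\}$$ be the central stable space, which is a linear subspace of $\mathbb R^p$, and let $$W^s(x)=\{w\in\mathbb R^p:\ \operatorname{dist}(A_n(x)w,\mathbb Z^p)\to 0 \text{ as } n\to\infty\}$$ be the weak-stable space, where $\operatorname{dist}$ is the Euclidean distance. Then for $\mu$-almost every $x\in\Delta$ the following holds: for every linear subspace $G_0\subset\mathbb R^p$ transverse to $E^{cs}(x)$, in the sense that $G_0\cap E^{cs}(x)=\{0\}$,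 and every affine subspace $G\subset\mathbb R^p$ parallel to $G_0$ (that is, $G=v+G_0$ for some $v\in\mathbb R^p$), the Hausdorff dimension of $G\cap W^s(x)$ is equal to $0$ (the empty set having dimension $0$). -/

import Mathlib

open MeasureTheory Filter Topology
open scoped ENNReal

/-- The operator on the Euclidean space `ℝᵖ` given by an invertible matrix. -/
noncomputable def euclideanOp {p : ℕ} (B : GL (Fin p) ℝ) :
    EuclideanSpace ℝ (Fin p) →L[ℝ] EuclideanSpace ℝ (Fin p) :=
  Matrix.toEuclideanCLM (n := Fin p) (𝕜 := ℝ) (B : Matrix (Fin p) (Fin p) ℝ)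

/-- `A_n(x) = A(T^{n-1}(x)) ⋯ A(T(x)) A(x)`, with `A_0(x) = 1`. -/
def cocycleIter {Δ : Type*} {p : ℕ} (T : Δ → Δ) (A : Δ → GL (Fin p) ℝ) :
    ℕ → Δ → GL (Fin p) ℝ
  | 0, _ => 1
  | n + 1, x => A (T^[n] x) * cocycleIter T A n x

/-- A measurable cocycle over `(Δ, μ)`: `μ` is a `T`-invariant ergodic measure (`Ergodic` includes
measurability of `T` and invariance of `μ`), `A` is measurable, and
`∫ log ‖A(x)‖ dμ < ∞` for the operator norm induced by the Euclidean norm.  The last condition is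
finiteness of the integral of the positive part, so that the integral is a well defined element of
`[-∞, ∞)`; no bound on the negative part is imposed. -/
structure IsMeasurableCocycle {Δ : Type*} [MeasurableSpace Δ] {p : ℕ} (μ : Measure Δ)
    (T : Δ → Δ) (A : Δ → GL (Fin p) ℝ) : Prop where
  isProbabilityMeasure : IsProbabilityMeasure μ
  ergodic : Ergodic T μ
  measurable : ∀ i j, Measurable fun x => (A x : Matrix (Fin p) (Fin p) ℝ) i j
  lintegral_log_lt_top : ∫⁻ x, ENNReal.ofReal (Real.log ‖euclideanOp (A x)‖) ∂μ < ∞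

/-- Sequences of at most subexponential growth are stable under domination by a constant multiple
of a maximum. -/
theorem limsup_root_le_one {u v w : ℕ → ℝ≥0∞} {K : ℝ≥0∞} (hK : K ≠ ∞) (hK0 : K ≠ 0)
    (h : ∀ n, w n ≤ K * max (u n) (v n))
    (hu : limsup (fun n : ℕ => u n ^ (1 / (n : ℝ))) atTop ≤ 1)
    (hv : limsup (fun n : ℕ => v n ^ (1 / (n : ℝ))) atTop ≤ 1) :
    limsup (fun n : ℕ => w n ^ (1 / (n : ℝ))) atTop ≤ 1 := by
  have hpos : ∀ n : ℕ, 0 ≤ 1 / (n : ℝ) := fun n => by positivity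
  have h1 : Tendsto (fun n : ℕ => K ^ (1 / (n : ℝ))) atTop (𝓝 1) := by
    lift K to NNReal using hK
    have hK0' : K ≠ 0 := by simpa using hK0
    have : Tendsto (fun n : ℕ => K ^ (1 / (n : ℝ))) atTop (𝓝 (K ^ (0 : ℝ))) :=
      ((NNReal.continuousAt_rpow (x := K) (y := 0) (Or.inl hK0')).tendsto).comp
        ((tendsto_const_nhds).prodMk_nhds tendsto_one_div_atTop_nhds_zero_nat)
    rw [NNReal.rpow_zero] at this
    have h2 := ENNReal.tendsto_coe.2 this
    refine h2.congr fun n => ?_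
    rw [ENNReal.coe_rpow_of_nonneg _ (hpos n)]
  have h3 : limsup (fun n : ℕ => max (u n ^ (1 / (n : ℝ))) (v n ^ (1 / (n : ℝ)))) atTop ≤ 1 := by
    rw [limsup_max]
    exact max_le hu hv
  calc limsup (fun n : ℕ => w n ^ (1 / (n : ℝ))) atTop
      ≤ limsup ((fun n : ℕ => K ^ (1 / (n : ℝ))) *
          (fun n : ℕ => max (u n ^ (1 / (n : ℝ))) (v n ^ (1 / (n : ℝ))))) atTop := by
        refine limsup_le_limsup (Eventually.of_forall fun n => ?_)
        simp only [Pi.mul_apply]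
        calc w n ^ (1 / (n : ℝ)) ≤ (K * max (u n) (v n)) ^ (1 / (n : ℝ)) :=
              ENNReal.rpow_le_rpow (h n) (hpos n)
          _ = K ^ (1 / (n : ℝ)) * max (u n) (v n) ^ (1 / (n : ℝ)) :=
              ENNReal.mul_rpow_of_nonneg _ _ (hpos n)
          _ = _ := by rw [(ENNReal.monotone_rpow_of_nonneg (hpos n)).map_max]
    _ ≤ limsup (fun n : ℕ => K ^ (1 / (n : ℝ))) atTop *
          limsup (fun n : ℕ => max (u n ^ (1 / (n : ℝ))) (v n ^ (1 / (n : ℝ)))) atTop := by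
        apply ENNReal.limsup_mul_le'
        · left; rw [h1.limsup_eq]; exact one_ne_zero
        · left; rw [h1.limsup_eq]; exact ENNReal.one_ne_top
    _ ≤ 1 := by rw [h1.limsup_eq, one_mul]; exact h3

/-- The central stable space `E^{cs}(x) = {w | limsup ‖A_n(x) w‖^{1/n} ≤ 1}`, a linear subspace.
The `limsup` is taken in `[0, ∞]`. -/
noncomputable def centralStableSpace {Δ : Type*} {p : ℕ} (T : Δ → Δ) (A : Δ → GL (Fin p) ℝ)
    (x : Δ) : Submodule ℝ (EuclideanSpace ℝ (Fin p)) where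
  carrier := {w | limsup (fun n : ℕ =>
    ‖euclideanOp (cocycleIter T A n x) w‖ₑ ^ (1 / (n : ℝ))) atTop ≤ 1}
  zero_mem' := by
    refine (limsup_le_limsup (v := fun _ => (1 : ℝ≥0∞)) (Eventually.of_forall fun n => ?_)).trans
      (limsup_const 1).le
    simp only [map_zero, enorm_zero]
    rcases (show (0 : ℝ) ≤ 1 / (n : ℝ) by positivity).eq_or_lt with h | h
    · rw [← h, ENNReal.rpow_zero]
    · rw [ENNReal.zero_rpow_of_pos h]; exact zero_le_one
  add_mem' {a b} ha hb := by
    refine limsup_root_le_one (K := 2) (by simp) (by simp) (fun n => ?_) ha hb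
    rw [map_add, two_mul]
    exact (enorm_add_le _ _).trans (add_le_add (le_max_left _ _) (le_max_right _ _))
  smul_mem' c a ha := by
    refine limsup_root_le_one (K := ‖c‖ₑ + 1) (by simp) (by simp) (fun n => ?_) ha ha
    rw [map_smul, enorm_smul, max_self]
    gcongr
    exact le_self_add

/-- The lattice `ℤᵖ` in the Euclidean space `ℝᵖ`. -/
def integerLattice (p : ℕ) : Set (EuclideanSpace ℝ (Fin p)) :=
  {v | ∀ i, ∃ k : ℤ, v i = k}

/-- The weak-stable space: the vectors `w` such that the Euclidean distance of `A_n(x) w` from the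
lattice `ℤᵖ` tends to `0`. -/
def weakStableSpace {Δ : Type*} {p : ℕ} (T : Δ → Δ) (A : Δ → GL (Fin p) ℝ) (x : Δ) :
    Set (EuclideanSpace ℝ (Fin p)) :=
  {w | Tendsto (fun n : ℕ =>
    Metric.infDist (euclideanOp (cocycleIter T A n x) w) (integerLattice p)) atTop (𝓝 0)}

/-! The proof plays an entropy bound for lattice itineraries against exponential expansion along
`G₀`.

Fix a small `δ`. A point of `W^s(x)` stays `δ`-close to the lattice from some time on, so its orbit
shadows a sequence of lattice points. Given the lattice point at time `k`, the next one lies in a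
ball of radius at most `2δM`, where `M = max 1 ‖A(T^k x)‖`, which leaves at most `⌈4δM⌉^p` choices
(`exists_finset_itineraries`). By Birkhoff, the number of itineraries of length `n` grows at a rate
close to `∫ p log ⌈4δM⌉`. This tends to `0` with `δ`: pointwise the ceiling is eventually `1`, and
`log⁺ ‖A‖` dominates (`tendsto_integral_branchingRate`). Two points of `G` near the same lattice
point at time `n` differ by a vector of `G₀` whose image has length at most `2δ`. If `A_n` expands
`G₀` by `c e^{nl}`, they are exponentially close. Since `l` does not depend on `δ`, every Hausdorff
measure of positive dimension vanishes (`hausdorffMeasure_eq_zero_of_covers`).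

The remaining work is the uniform expansion of `G₀` (`ae_uniform_growth`), a one-sided fragment of
the Oseledets theorem with no integrability of `log⁻ ‖A‖`. Kingman's theorem, applied to sums of
minors, gives rates `τ i ≥ 0` for the singular values truncated below by `1`. Subexponential
one-step growth of `A_n` limits the rotation of the singular bases: a singular vector of rate `0` at
time `m` has grown subexponentially at every large earlier time (`eventually_norm_apply_slow_le`).
If expansion failed, unit vectors of `G₀` nearly contained in such slow spans would accumulate at a
unit vector of `G₀ ∩ E^{cs}(x)`. -/

/-! ### Block decompositions of orbits and the ergodic theorems of Birkhoff and Kingman. -/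

/-- If from every point some block of length at most `N` has sum at least `c` per unit of time,
then all Birkhoff sums are at least `c (n - N)`. -/
theorem le_birkhoffSum_of_blocks {α : Type*} {T : α → α} {f : α → ℝ} (hf : ∀ x, 0 ≤ f x)
    {c : ℝ} (hc : 0 ≤ c) {N : ℕ}
    (h : ∀ x, ∃ l, 1 ≤ l ∧ l ≤ N ∧ c * l ≤ birkhoffSum T f l x) (n : ℕ) (x : α) :
    c * ((n : ℝ) - N) ≤ birkhoffSum T f n x := by
  induction n using Nat.strong_induction_on generalizing x with
  | _ n ih =>
    rcases le_or_gt n N with hn | hn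
    · have h1 : (n : ℝ) ≤ N := by exact_mod_cast hn
      have h2 : 0 ≤ birkhoffSum T f n x := Finset.sum_nonneg fun _ _ => hf _
      nlinarith
    · obtain ⟨l, hl1, hlN, hl⟩ := h x
      have h1 := ih (n - l) (by omega) (T^[l] x)
      have h2 := birkhoffSum_add T f l (n - l) x
      rw [Nat.add_sub_cancel' (by omega)] at h2
      rw [Nat.cast_sub (by omega)] at h1
      rw [h2]
      nlinarith

/-- If from every point some block of length at most `N` is dominated by the Birkhoff sum of `h`,
then a subadditive sequence is dominated by the Birkhoff sum of `h` up to the last `N` terms. -/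
theorem subadditive_le_of_blocks {α : Type*} {T : α → α} {g : ℕ → α → ℝ} {h : α → ℝ}
    (hg1 : ∀ x, 0 ≤ g 1 x)
    (hsub : ∀ m n x, g (m + n) x ≤ g m x + g n (T^[m] x)) (hh : ∀ x, 0 ≤ h x) {N : ℕ}
    (hb : ∀ x, ∃ l, 1 ≤ l ∧ l ≤ N ∧ g l x ≤ birkhoffSum T h l x) (n : ℕ) (hn1 : 1 ≤ n) (x : α) :
    g n x ≤ birkhoffSum T h n x + ∑ k ∈ Finset.Ico (n - N) n, g 1 (T^[k] x) := by
  induction n using Nat.strong_induction_on generalizing x with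
  | _ n ih =>
    rcases lt_or_ge n N with hn | hn
    · have h2 : 0 ≤ birkhoffSum T h n x := Finset.sum_nonneg fun _ _ => hh _
      have h3 : ∀ n, 1 ≤ n → ∀ x, g n x ≤ ∑ k ∈ Finset.range n, g 1 (T^[k] x) := by
        intro n hn x
        induction n, hn using Nat.le_induction with
        | base => simp
        | succ n hn ih' =>
          rw [Finset.sum_range_succ]
          exact (hsub n 1 x).trans (by gcongr)
      have := h3 n hn1 x
      rw [Nat.sub_eq_zero_of_le hn.le, ← Finset.range_eq_Ico]
      linarith
    · obtain ⟨l, hl1, hlN, hl⟩ := hb x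
      have h0 : 0 ≤ ∑ k ∈ Finset.Ico (n - N) n, g 1 (T^[k] x) :=
        Finset.sum_nonneg fun _ _ => hg1 _
      -- A block ending exactly at `n` is separated out, because nothing bounds `g 0` from above.
      rcases (hlN.trans hn).eq_or_lt with rfl | hln
      · linarith
      have h1 := ih (n - l) (by omega) (by omega) (T^[l] x)
      have h2 := birkhoffSum_add T h l (n - l) x
      have h3 := hsub l (n - l) x
      rw [Nat.add_sub_cancel' (by omega)] at h2 h3
      have h4 : ∑ k ∈ Finset.Ico (n - l - N) (n - l), g 1 (T^[k] (T^[l] x)) ≤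
          ∑ k ∈ Finset.Ico (n - N) n, g 1 (T^[k] x) := by
        simp_rw [← Function.iterate_add_apply]
        rw [Finset.sum_Ico_add' (fun k => g 1 (T^[k] x))]
        refine Finset.sum_le_sum_of_subset_of_nonneg (fun k hk => ?_) fun _ _ _ => hg1 _
        simp only [Finset.mem_Ico] at hk ⊢
        omega
      linarith

section Ergodic

variable {α : Type*} [MeasurableSpace α] {μ : Measure α} {T : α → α}

theorem Measurable.birkhoffSum (hT : Measurable T) {f : α → ℝ} (hf : Measurable f) (n : ℕ) :
    Measurable (birkhoffSum T f n) := by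
  unfold _root_.birkhoffSum
  exact Finset.measurable_fun_sum _ fun k _ => hf.comp (hT.iterate k)

theorem integral_birkhoffSum (hT : MeasurePreserving T μ μ) {f : α → ℝ}
    (hf : Integrable f μ) (n : ℕ) :
    Integrable (birkhoffSum T f n) μ ∧ ∫ x, birkhoffSum T f n x ∂μ = n * ∫ x, f x ∂μ := by
  have h1 : ∀ k, Integrable (fun x => f (T^[k] x)) μ := fun k =>
    (hT.iterate k).integrable_comp_of_integrable hf
  have h2 : ∀ k, ∫ x, f (T^[k] x) ∂μ = ∫ x, f x ∂μ := fun k => by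
    have h := hT.iterate k
    conv_rhs => rw [← h.map_eq]
    rw [integral_map h.measurable.aemeasurable]
    rw [h.map_eq]; exact hf.aestronglyMeasurable
  unfold birkhoffSum
  refine ⟨integrable_finsetSum _ fun k _ => h1 k, ?_⟩
  rw [integral_finsetSum _ fun k _ => h1 k]
  simp [h2]

/-- A measurable set containing its preimage is null or conull. -/
theorem Ergodic.ae_or_ae_not [IsProbabilityMeasure μ] (hT : Ergodic T μ) {P : α → Prop}
    (hP : MeasurableSet {x | P x}) (h : ∀ x, P (T x) → P x) :
    (∀ᵐ x ∂μ, P x) ∨ ∀ᵐ x ∂μ, ¬ P x := by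
  rcases hT.ae_empty_or_univ_of_preimage_ae_le hP.nullMeasurableSet
    (Eventually.of_forall fun x hx => h x hx) with h1 | h1
  · right
    filter_upwards [h1] with x hx hPx
    exact (Set.mem_empty_iff_false x).1 ((iff_of_eq hx).1 hPx)
  · left
    filter_upwards [h1] with x hx
    exact (iff_of_eq hx).2 (Set.mem_univ x)

/-- Here `P l x` means that the block of length `l` from `x` is good. The points without a good
block of length at most `N` form sets decreasing to a null set, so repairing them costs little once
`N` is large. -/
theorem tendsto_setIntegral_exception [IsProbabilityMeasure μ] {P : ℕ → α → Prop}
    (hP : ∀ l, MeasurableSet {x | P l x}) (hex : ∀ᵐ x ∂μ, ∃ l, 1 ≤ l ∧ P l x) {f : α → ℝ}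
    (hf : Integrable f μ) :
    Tendsto (fun N : ℕ => ∫ x in {x | ∀ l, 1 ≤ l → l ≤ N → ¬ P l x}, f x ∂μ) atTop (𝓝 0) := by
  have hm : ∀ N : ℕ, MeasurableSet {x | ∀ l, 1 ≤ l → l ≤ N → ¬ P l x} := fun N => by
    simp only [Set.ofPred_forall]
    exact MeasurableSet.iInter fun l => MeasurableSet.iInter fun _ => MeasurableSet.iInter fun _ =>
      (hP l).compl
  have h0 : ∫ x in ⋂ N : ℕ, {x | ∀ l, 1 ≤ l → l ≤ N → ¬ P l x}, f x ∂μ = 0 := by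
    refine setIntegral_measure_zero _ ?_
    rw [measure_eq_zero_iff_ae_notMem]
    filter_upwards [hex] with x ⟨l, hl, hlx⟩ hx
    exact Set.mem_iInter.1 hx l l hl le_rfl hlx
  rw [← h0]
  exact tendsto_setIntegral_of_antitone hm
    (fun a b hab x hx l hl hla => hx l hl (hla.trans hab)) ⟨0, hf.integrableOn⟩

/-- The upper half of Birkhoff's ergodic theorem for nonnegative functions. -/
theorem Ergodic.eventually_birkhoffSum_le [IsProbabilityMeasure μ] (hT : Ergodic T μ) {f : α → ℝ}
    (hfm : Measurable f) (hf0 : ∀ x, 0 ≤ f x) (hf : Integrable f μ) {c : ℝ}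
    (hc : ∫ x, f x ∂μ < c) : ∀ᵐ x ∂μ, ∀ᶠ n : ℕ in atTop, birkhoffSum T f n x ≤ c * n := by
  have hTm := hT.measurable
  have hc0 : 0 < c := (integral_nonneg hf0).trans_lt hc
  -- The slack `K` makes the event contain its preimage: one step shifts `c * n` by `c`, which a
  -- larger `K` absorbs.
  rcases hT.ae_or_ae_not (P := fun x => ∃ K : ℕ, ∃ᶠ n : ℕ in atTop, c * n - K < birkhoffSum T f n x)
    (by
      simp only [frequently_atTop, Set.ofPred_exists, Set.ofPred_forall]
      refine MeasurableSet.iUnion fun K => MeasurableSet.iInter fun a => MeasurableSet.iUnion fun b =>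
        ?_
      simp only [Set.ofPred_and]
      exact (MeasurableSet.const _).inter
        (measurableSet_lt measurable_const (hTm.birkhoffSum hfm _)))
    (by
      rintro x ⟨K, hK⟩
      obtain ⟨K', hK'⟩ := exists_nat_ge (K + c)
      refine ⟨K', ?_⟩
      refine (tendsto_add_atTop_nat 1).frequently (hK.mono fun n hn => ?_)
      rw [birkhoffSum_succ']
      push_cast
      linarith [hf0 x]) with h | h
  · exfalso
    obtain ⟨c', hc', hcc⟩ := exists_between hc
    have hc0' : 0 < c' := (integral_nonneg hf0).trans_lt hc'
    have hex : ∀ᵐ x ∂μ, ∃ l : ℕ, 1 ≤ l ∧ c' * l ≤ birkhoffSum T f l x := by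
      filter_upwards [h] with x ⟨K, hK⟩
      obtain ⟨M, hM⟩ := exists_nat_ge (K / (c - c'))
      obtain ⟨n, hn1, hn2⟩ := (frequently_atTop.1 hK) (M + 1)
      refine ⟨n, by omega, ?_⟩
      rw [div_le_iff₀ (by linarith)] at hM
      have : (M : ℝ) + 1 ≤ n := by exact_mod_cast hn1
      nlinarith
    have hlim := tendsto_setIntegral_exception (μ := μ)
      (P := fun l x => c' * l ≤ birkhoffSum T f l x)
      (fun l => measurableSet_le measurable_const (hTm.birkhoffSum hfm _)) hex
      (integrable_const c')
    obtain ⟨N, hN⟩ := ((hlim.eventually (gt_mem_nhds (sub_pos.2 hc'))).and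
      (eventually_ge_atTop 1)).exists
    obtain ⟨hN, hN1⟩ := hN
    set B := {x | ∀ l : ℕ, 1 ≤ l → l ≤ N → ¬ c' * l ≤ birkhoffSum T f l x} with hB
    have hBm : MeasurableSet B := by
      simp only [hB, Set.ofPred_forall]
      exact MeasurableSet.iInter fun l => MeasurableSet.iInter fun _ => MeasurableSet.iInter fun _ =>
        (measurableSet_le measurable_const (hTm.birkhoffSum hfm _)).compl
    -- Adding `c'` on `B` makes the one-step block good there. The cost is less than `c' - ∫ f`, so
    -- `∫ h' < c'`, whereas integrating the block estimate over long orbits forces `c' ≤ ∫ h'`.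
    set h' : α → ℝ := fun x => f x + B.indicator (fun _ => c') x with hh'
    have hi0 : ∀ x, 0 ≤ B.indicator (fun _ => c') x := fun x =>
      Set.indicator_nonneg (fun _ _ => hc0'.le) x
    have hi : Integrable (B.indicator (fun _ => c')) μ := (integrable_const c').indicator hBm
    have hint : Integrable h' μ := hf.add hi
    have hint_eq : ∫ x, h' x ∂μ = ∫ x, f x ∂μ + ∫ x in B, c' ∂μ := by
      rw [hh', integral_add hf hi, integral_indicator hBm]
    have key := le_birkhoffSum_of_blocks (T := T) (f := h') (fun x => add_nonneg (hf0 x) (hi0 x))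
      hc0'.le (N := N) (fun x => by
        by_cases hx : x ∈ B
        · refine ⟨1, le_rfl, hN1, ?_⟩
          simp [hh', hx, hf0 x]
        · simp only [hB, Set.mem_ofPred_eq, not_forall, not_not] at hx
          obtain ⟨l, h1, h2, h3⟩ := hx
          refine ⟨l, h1, h2, h3.trans ?_⟩
          exact Finset.sum_le_sum fun k _ => le_add_of_nonneg_right (hi0 _))
    have key2 : ∀ n : ℕ, c' * ((n : ℝ) - N) ≤ n * ∫ x, h' x ∂μ := fun n => by
      obtain ⟨h1, h2⟩ := integral_birkhoffSum hT.toMeasurePreserving hint n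
      rw [← h2]
      have := integral_mono (integrable_const (μ := μ) (c' * ((n : ℝ) - N))) h1 (key n)
      simpa using this
    have hlt : ∫ x, h' x ∂μ < c' := by rw [hint_eq]; linarith
    obtain ⟨n, hn⟩ := exists_nat_gt (c' * N / (c' - ∫ x, h' x ∂μ))
    rw [div_lt_iff₀ (by linarith)] at hn
    have := key2 n
    nlinarith
  · filter_upwards [h] with x hx
    push Not at hx
    filter_upwards [hx 0] with n hn
    simpa using hn

/-- An integrable function grows sublinearly along almost every orbit. -/
theorem Ergodic.eventually_comp_iterate_le [IsProbabilityMeasure μ] (hT : Ergodic T μ) {f : α → ℝ}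
    (hfm : Measurable f) (hf0 : ∀ x, 0 ≤ f x) (hf : Integrable f μ) :
    ∀ᵐ x ∂μ, ∀ ε : ℝ, 0 < ε → ∀ᶠ n : ℕ in atTop, f (T^[n] x) ≤ ε * n := by
  have key : ∀ j : ℕ, ∀ᵐ x ∂μ, ∀ᶠ n : ℕ in atTop, f (T^[n] x) ≤ (1 / ((j : ℝ) + 1)) * n := by
    intro j
    set ε := 1 / ((j : ℝ) + 1)
    have hε : 0 < ε := by positivity
    have hlim := tendsto_setIntegral_exception (μ := μ) (P := fun l x => f x ≤ l)
      (fun l => measurableSet_le hfm measurable_const)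
      (Eventually.of_forall fun x => by
        obtain ⟨l, hl⟩ := exists_nat_ge (f x)
        exact ⟨l + 1, by omega, by push_cast; linarith⟩) hf
    obtain ⟨M, hM, hM1⟩ := ((hlim.eventually (gt_mem_nhds (half_pos (half_pos hε)))).and
      (eventually_ge_atTop 1)).exists
    set B := {x | ∀ l : ℕ, 1 ≤ l → l ≤ M → ¬ f x ≤ l} with hB
    have hBm : MeasurableSet B := by
      simp only [hB, Set.ofPred_forall]
      exact MeasurableSet.iInter fun l => MeasurableSet.iInter fun _ => MeasurableSet.iInter fun _ =>
        (measurableSet_le hfm measurable_const).compl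
    rw [← integral_indicator hBm] at hM
    filter_upwards [hT.eventually_birkhoffSum_le (hfm.indicator hBm)
      (fun x => Set.indicator_nonneg (fun _ _ => hf0 _) x) (hf.indicator hBm) hM] with x hx
    obtain ⟨n0, hn0⟩ := exists_nat_gt ((M + ε) / (ε / 2))
    filter_upwards [(tendsto_add_atTop_nat 1).eventually hx, eventually_ge_atTop n0] with n hn hn1
    -- The value `f (T^[n] x)` is either at most `M` or the last term of a Birkhoff sum of `f` cut
    -- off to `B = {f > M}`, whose mean is below `ε / 4`.
    have h1 : f (T^[n] x) ≤ M + birkhoffSum T (B.indicator f) (n + 1) x := by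
      rw [birkhoffSum_succ]
      have h2 : 0 ≤ birkhoffSum T (B.indicator f) n x :=
        Finset.sum_nonneg fun _ _ => Set.indicator_nonneg (fun _ _ => hf0 _) _
      by_cases hb : T^[n] x ∈ B
      · rw [Set.indicator_of_mem hb]
        have : (0 : ℝ) ≤ M := by positivity
        linarith
      · rw [Set.indicator_of_notMem hb]
        simp only [hB, Set.mem_ofPred_eq, not_forall, not_not] at hb
        obtain ⟨l, _, h3, h4⟩ := hb
        have : (l : ℝ) ≤ M := by exact_mod_cast h3
        linarith
    have h5 : (n0 : ℝ) ≤ n := by exact_mod_cast hn1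
    rw [div_lt_iff₀ (by positivity)] at hn0
    push_cast at hn
    nlinarith
  filter_upwards [ae_all_iff.2 key] with x hx ε hε
  obtain ⟨j, hj⟩ := exists_nat_one_div_lt hε
  filter_upwards [hx j] with n hn
  exact hn.trans (by gcongr)

/-- Kingman's subadditive ergodic theorem for nonnegative subadditive sequences. -/
theorem Ergodic.exists_tendsto_of_subadditive [IsProbabilityMeasure μ] (hT : Ergodic T μ)
    {g : ℕ → α → ℝ} (hgm : ∀ n, Measurable (g n)) (hg0 : ∀ n x, 0 ≤ g n x)
    (hsub : ∀ m n x, g (m + n) x ≤ g m x + g n (T^[m] x)) (hint : Integrable (g 1) μ) :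
    ∃ γ : ℝ, ∀ᵐ x ∂μ, Tendsto (fun n : ℕ => g n x / n) atTop (𝓝 γ) := by
  have hTm := hT.measurable
  -- This says that the lower growth rate is at most about `c`; the constant `K` again gives
  -- invariance, hence a zero-one alternative for each `c`.
  set L : ℝ → α → Prop := fun c x => ∃ K : ℕ, ∃ᶠ n : ℕ in atTop, g n x < c * n + K with hL
  have hLm : ∀ c, MeasurableSet {x | L c x} := fun c => by
    simp only [hL, frequently_atTop, Set.ofPred_exists, Set.ofPred_forall]
    refine MeasurableSet.iUnion fun K => MeasurableSet.iInter fun a => MeasurableSet.iUnion fun b =>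
      ?_
    simp only [Set.ofPred_and]
    exact (MeasurableSet.const _).inter (measurableSet_lt (hgm _) measurable_const)
  have hdich : ∀ c, (∀ᵐ x ∂μ, L c x) ∨ ∀ᵐ x ∂μ, ¬ L c x := fun c => by
    refine hT.ae_or_ae_not (hLm c) ?_
    rintro x ⟨K, hK⟩
    obtain ⟨K', hK'⟩ := exists_nat_ge (K - c + g 1 x)
    refine ⟨K', (tendsto_add_atTop_nat 1).frequently (hK.mono fun n hn => ?_)⟩
    have := hsub 1 n x
    rw [add_comm 1 n, Function.iterate_one] at this
    push_cast
    linarith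
  have hneg : ∀ c < 0, ∀ x, ¬ L c x := by
    rintro c hc x ⟨K, hK⟩
    obtain ⟨M, hM⟩ := exists_nat_ge (K / (-c))
    obtain ⟨n, hn1, hn2⟩ := frequently_atTop.1 hK M
    rw [div_le_iff₀ (by linarith)] at hM
    have : (M : ℝ) ≤ n := by exact_mod_cast hn1
    have := hg0 n x
    nlinarith
  have hgS : ∀ n, 1 ≤ n → ∀ x, g n x ≤ birkhoffSum T (g 1) n x := by
    intro n hn x
    induction n, hn using Nat.le_induction with
    | base => simp
    | succ n hn ih' =>
      rw [birkhoffSum_succ]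
      exact (hsub n 1 x).trans (by gcongr)
  have hbig : ∀ c, ∫ x, g 1 x ∂μ < c → ∀ᵐ x ∂μ, L c x := fun c hc => by
    filter_upwards [hT.eventually_birkhoffSum_le (hgm 1) (hg0 1) hint hc] with x hx
    refine ⟨1, Eventually.frequently ?_⟩
    filter_upwards [hx, eventually_ge_atTop 1] with n hn hn1
    have := hgS n hn1 x
    push_cast
    linarith
  have hup : ∀ c d, c < d → (∀ᵐ x ∂μ, L c x) → ∀ᵐ x ∂μ, ∀ᶠ n : ℕ in atTop, g n x ≤ d * n := by
    intro c d hcd hc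
    have hc0 : 0 ≤ c := by
      by_contra hneg'
      obtain ⟨x, hx⟩ := hc.exists
      exact hneg c (not_le.1 hneg') x hx
    obtain ⟨e, hce, hed⟩ := exists_between hcd
    have hex : ∀ᵐ x ∂μ, ∃ l : ℕ, 1 ≤ l ∧ g l x ≤ e * l := by
      filter_upwards [hc] with x ⟨K, hK⟩
      obtain ⟨M, hM⟩ := exists_nat_ge (K / (e - c))
      obtain ⟨n, hn1, hn2⟩ := (frequently_atTop.1 hK) (M + 1)
      refine ⟨n, by omega, ?_⟩
      rw [div_le_iff₀ (by linarith)] at hM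
      have : (M : ℝ) + 1 ≤ n := by exact_mod_cast hn1
      nlinarith
    have hlim := tendsto_setIntegral_exception (μ := μ) (P := fun l x => g l x ≤ e * l)
      (fun l => measurableSet_le (hgm _) measurable_const) hex hint
    obtain ⟨N, hN, hN1⟩ := ((hlim.eventually (gt_mem_nhds (half_pos (sub_pos.2 hed)))).and
      (eventually_ge_atTop 1)).exists
    set B := {x | ∀ l : ℕ, 1 ≤ l → l ≤ N → ¬ g l x ≤ e * l} with hB
    have hBm : MeasurableSet B := by
      simp only [hB, Set.ofPred_forall]
      exact MeasurableSet.iInter fun l => MeasurableSet.iInter fun _ => MeasurableSet.iInter fun _ =>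
        (measurableSet_le (hgm _) measurable_const).compl
    -- Good blocks cost `e` per unit of time, and points of `B` use a one-step block of cost `g 1`.
    set h : α → ℝ := fun x => e + B.indicator (g 1) x with hh
    have hi0 : ∀ x, 0 ≤ B.indicator (g 1) x := fun x => Set.indicator_nonneg (fun _ _ => hg0 1 _) x
    have he0 : 0 ≤ e := hc0.trans hce.le
    have hh0 : ∀ x, 0 ≤ h x := fun x => add_nonneg he0 (hi0 x)
    have hhm : Measurable h := measurable_const.add ((hgm 1).indicator hBm)
    have hhi : Integrable h μ := (integrable_const e).add (hint.indicator hBm)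
    have hhint : ∫ x, h x ∂μ < (e + d) / 2 := by
      rw [hh, integral_add (integrable_const e) (hint.indicator hBm), integral_indicator hBm]
      simp only [integral_const, probReal_univ, smul_eq_mul, one_mul]
      linarith
    have key := subadditive_le_of_blocks (T := T) (g := g) (h := h) (hg0 1) hsub hh0 (N := N)
      (fun x => by
        by_cases hx : x ∈ B
        · refine ⟨1, le_rfl, hN1, ?_⟩
          simp [hh, hx, he0]
        · simp only [hB, Set.mem_ofPred_eq, not_forall, not_not] at hx
          obtain ⟨l, h1, h2, h3⟩ := hx
          refine ⟨l, h1, h2, h3.trans ?_⟩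
          have : ∑ k ∈ Finset.range l, e ≤ birkhoffSum T h l x :=
            Finset.sum_le_sum fun k _ => le_add_of_nonneg_right (hi0 _)
          simpa [mul_comm] using this)
    filter_upwards [hT.eventually_birkhoffSum_le hhm hh0 hhi hhint,
      hT.eventually_comp_iterate_le (hgm 1) (hg0 1) hint] with x hx1 hx2
    -- Each of the `N` trailing terms is at most this multiple of `n`, so together they fill the gap
    -- between `(e + d) / 2` and `d`.
    have hη : 0 < (d - e) / 2 / N := by
      have : (0 : ℝ) < N := by exact_mod_cast hN1
      have := sub_pos.2 hed
      positivity
    obtain ⟨M, hM⟩ := eventually_atTop.1 (hx2 _ hη)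
    filter_upwards [hx1, eventually_ge_atTop (M + N + 1)] with n hn hnM
    have h1 := key n (by omega) x
    have h2 : ∑ k ∈ Finset.Ico (n - N) n, g 1 (T^[k] x) ≤
        ∑ k ∈ Finset.Ico (n - N) n, (d - e) / 2 / N * n := by
      refine Finset.sum_le_sum fun k hk => ?_
      rw [Finset.mem_Ico] at hk
      refine (hM k (by omega)).trans ?_
      have : (k : ℝ) ≤ n := by exact_mod_cast hk.2.le
      gcongr
    rw [Finset.sum_const, Nat.card_Ico, Nat.sub_sub_self (by omega), nsmul_eq_mul] at h2
    have hN0 : (N : ℝ) ≠ 0 := by positivity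
    have h3 : (N : ℝ) * ((d - e) / 2 / N * n) = (d - e) / 2 * n := by field_simp
    linarith
  -- The limit is the infimum of the admissible levels: `hup` bounds `g n` above it, and failure of
  -- `L c` bounds `g n` from below under it.
  set S : Set ℝ := {c | ∀ᵐ x ∂μ, L c x} with hS
  have hSne : S.Nonempty := ⟨_, hbig _ (lt_add_one _)⟩
  have hSbdd : BddBelow S := ⟨0, fun c hc => by
    by_contra hneg'
    have hc' : ∀ᵐ x ∂μ, L c x := hc
    obtain ⟨x, hx⟩ := hc'.exists
    exact hneg c (not_le.1 hneg') x hx⟩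
  have hu : ∀ c, sInf S < c → ∀ᵐ x ∂μ, ∀ᶠ n : ℕ in atTop, g n x ≤ c * n := fun c hc => by
    obtain ⟨d, hd, hdc⟩ := exists_lt_of_csInf_lt hSne hc
    exact hup d c hdc hd
  have hl : ∀ c, c < sInf S → ∀ᵐ x ∂μ, ∀ᶠ n : ℕ in atTop, c * n ≤ g n x := fun c hc => by
    rcases hdich c with h | h
    · exact absurd (csInf_le hSbdd h) (not_le.2 hc)
    · filter_upwards [h] with x hx
      simp only [hL, not_exists, not_frequently, not_lt] at hx
      simpa using hx 0
  refine ⟨sInf S, ?_⟩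
  have hu' : ∀ q : ℚ, ∀ᵐ x ∂μ, sInf S < q → ∀ᶠ n : ℕ in atTop, g n x ≤ q * n := fun q => by
    by_cases h : sInf S < q
    · filter_upwards [hu q h] with x hx _ using hx
    · exact Eventually.of_forall fun x h' => absurd h' h
  have hl' : ∀ q : ℚ, ∀ᵐ x ∂μ, q < sInf S → ∀ᶠ n : ℕ in atTop, q * n ≤ g n x := fun q => by
    by_cases h : q < sInf S
    · filter_upwards [hl q h] with x hx _ using hx
    · exact Eventually.of_forall fun x h' => absurd h' h
  filter_upwards [ae_all_iff.2 hu', ae_all_iff.2 hl'] with x hxu hxl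
  refine tendsto_order.2 ⟨fun a ha => ?_, fun b hb => ?_⟩
  · obtain ⟨q, hq1, hq2⟩ := exists_rat_btwn ha
    filter_upwards [hxl q hq2, eventually_gt_atTop 0] with n hn hn0
    have : (0 : ℝ) < n := by exact_mod_cast hn0
    exact hq1.trans_le ((le_div_iff₀ this).2 hn)
  · obtain ⟨q, hq1, hq2⟩ := exists_rat_btwn hb
    filter_upwards [hxu q hq1, eventually_gt_atTop 0] with n hn hn0
    have : (0 : ℝ) < n := by exact_mod_cast hn0
    exact ((div_le_iff₀ this).2 hn).trans_lt hq2

end Ergodic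

/-! ### Minors as a submultiplicative measure of growth. -/

namespace Matrix

/-- The Cauchy–Binet formula, summed over all choices of columns instead of increasing ones. -/
theorem factorial_mul_det_mul {j p : ℕ} (X : Matrix (Fin j) (Fin p) ℝ)
    (Y : Matrix (Fin p) (Fin j) ℝ) :
    (j.factorial : ℝ) * (X * Y).det =
      ∑ h : Fin j → Fin p, (X.submatrix id h).det * (Y.submatrix h id).det := by
  have h1 : (X * Y).det = ∑ h : Fin j → Fin p, (∏ i, X i (h i)) * (Y.submatrix h id).det := by
    have : X * Y = fun i => ∑ k, X i k • Y k := by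
      ext i l
      simp [Matrix.mul_apply]
    rw [this]
    change detRowAlternating (fun i => ∑ k, X i k • Y k) = _
    rw [← AlternatingMap.coe_multilinearMap, MultilinearMap.map_sum]
    refine Finset.sum_congr rfl fun h _ => ?_
    rw [MultilinearMap.map_smul_univ]
    rfl
  -- Permuting the chosen indices by `π` leaves the sum unchanged; summing over `π` rebuilds the
  -- Leibniz expansion of the minor of `X`.
  have h2 : ∀ π : Equiv.Perm (Fin j), (X * Y).det =
      ∑ h : Fin j → Fin p, (Equiv.Perm.sign π : ℝ) * (∏ i, X i (h (π i))) *
        (Y.submatrix h id).det := by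
    intro π
    rw [h1, ← (Equiv.arrowCongr π.symm (Equiv.refl (Fin p))).sum_comp]
    refine Finset.sum_congr rfl fun h _ => ?_
    have h3 := det_permute π (Y.submatrix h id)
    rw [submatrix_submatrix] at h3
    have h4 : (Equiv.arrowCongr π.symm (Equiv.refl (Fin p))) h = h ∘ π := by
      ext; simp
    rw [h4]
    have h5 : (Y.submatrix (h ∘ π) id).det =
      (Equiv.Perm.sign π : ℝ) * (Y.submatrix h id).det := by
      rw [← h3]; rfl
    rw [h5]
    simp only [Function.comp_apply]
    ring
  have h3 : (j.factorial : ℝ) * (X * Y).det = ∑ π : Equiv.Perm (Fin j), (X * Y).det := by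
    simp [Finset.card_univ, Fintype.card_perm]
  rw [h3, Finset.sum_congr rfl fun π _ => h2 π, Finset.sum_comm]
  refine Finset.sum_congr rfl fun h _ => ?_
  rw [← Finset.sum_mul, ← det_transpose (X.submatrix id h),
    det_apply' (X.submatrix id h)ᵀ]
  rfl

/-- The sum of the absolute values of the minors of order `j`. -/
def minorSum {p : ℕ} (j : ℕ) (B : Matrix (Fin p) (Fin p) ℝ) : ℝ :=
  ∑ f : Fin j → Fin p, ∑ g : Fin j → Fin p, |(B.submatrix f g).det|

variable {p : ℕ}

theorem minorSum_nonneg (j : ℕ) (B : Matrix (Fin p) (Fin p) ℝ) : 0 ≤ minorSum j B :=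
  Finset.sum_nonneg fun _ _ => Finset.sum_nonneg fun _ _ => abs_nonneg _

theorem abs_det_submatrix_le (j : ℕ) (B : Matrix (Fin p) (Fin p) ℝ) (f g : Fin j → Fin p) :
    |(B.submatrix f g).det| ≤ minorSum j B :=
  (Finset.single_le_sum (f := fun g => |(B.submatrix f g).det|) (fun _ _ => abs_nonneg _)
    (Finset.mem_univ g)).trans
  (Finset.single_le_sum (f := fun f => ∑ g : Fin j → Fin p, |(B.submatrix f g).det|)
    (fun _ _ => Finset.sum_nonneg fun _ _ => abs_nonneg _) (Finset.mem_univ f))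

theorem minorSum_zero (B : Matrix (Fin p) (Fin p) ℝ) : minorSum 0 B = 1 := by
  simp [minorSum]

/-- Cauchy–Binet and the triangle inequality; the factor `j!` on the left is at least `1` and can be
dropped. -/
theorem minorSum_mul_le (j : ℕ) (A B : Matrix (Fin p) (Fin p) ℝ) :
    minorSum j (A * B) ≤ minorSum j A * minorSum j B := by
  have h1 : ∀ f g : Fin j → Fin p, |((A * B).submatrix f g).det| ≤
      ∑ h : Fin j → Fin p, |(A.submatrix f h).det| * |(B.submatrix h g).det| := by
    intro f g
    have h2 := factorial_mul_det_mul (A.submatrix f id) (B.submatrix id g)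
    have h3 : (A * B).submatrix f g = A.submatrix f id * B.submatrix id g := rfl
    rw [h3]
    have h4 : |(A.submatrix f id * B.submatrix id g).det| ≤
        (j.factorial : ℝ) * |(A.submatrix f id * B.submatrix id g).det| :=
      le_mul_of_one_le_left (abs_nonneg _) (by exact_mod_cast j.factorial_pos)
    refine h4.trans ?_
    have h5 : (j.factorial : ℝ) = |(j.factorial : ℝ)| := by simp
    rw [h5, ← abs_mul, h2]
    refine (Finset.abs_sum_le_sum_abs _ _).trans (le_of_eq ?_)
    exact Finset.sum_congr rfl fun h _ => by rw [abs_mul]; rfl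
  calc minorSum j (A * B)
      ≤ ∑ f : Fin j → Fin p, ∑ g : Fin j → Fin p, ∑ h : Fin j → Fin p,
          |(A.submatrix f h).det| * |(B.submatrix h g).det| :=
        Finset.sum_le_sum fun f _ => Finset.sum_le_sum fun g _ => h1 f g
    _ ≤ ∑ f : Fin j → Fin p, ∑ h : Fin j → Fin p, |(A.submatrix f h).det| * minorSum j B := by
        refine Finset.sum_le_sum fun f _ => ?_
        rw [Finset.sum_comm]
        refine Finset.sum_le_sum fun h _ => ?_
        rw [← Finset.mul_sum]
        refine mul_le_mul_of_nonneg_left ?_ (abs_nonneg _)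
        exact Finset.single_le_sum (f := fun f => ∑ g : Fin j → Fin p, |(B.submatrix f g).det|)
          (fun _ _ => Finset.sum_nonneg fun _ _ => abs_nonneg _) (Finset.mem_univ h)
    _ = minorSum j A * minorSum j B := by
        simp only [minorSum, Finset.sum_mul]

theorem minorSum_le_of_entry_le (j : ℕ) {B : Matrix (Fin p) (Fin p) ℝ} {c : ℝ}
    (h : ∀ i k, |B i k| ≤ c) :
    minorSum j B ≤ (p : ℝ) ^ j * ((p : ℝ) ^ j * (j.factorial * c ^ j)) := by
  have h1 : ∀ f g : Fin j → Fin p, |(B.submatrix f g).det| ≤ j.factorial * c ^ j := fun f g => by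
    have := det_le (A := B.submatrix f g) (abv := AbsoluteValue.abs) (x := c)
      (fun i k => h (f i) (g k))
    simpa using this
  calc minorSum j B ≤ ∑ f : Fin j → Fin p, ∑ g : Fin j → Fin p, (j.factorial * c ^ j : ℝ) :=
        Finset.sum_le_sum fun f _ => Finset.sum_le_sum fun g _ => h1 f g
    _ = _ := by simp

/-- The sum of the absolute values of the minors of order at most `q`. -/
def minorSumLE (q : ℕ) (B : Matrix (Fin p) (Fin p) ℝ) : ℝ :=
  ∑ j ∈ Finset.range (q + 1), minorSum j B

/-- The minor of order `0` contributes `1`. Hence logarithms are nonnegative, and the subadditive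
theorem applies without control of `log⁻ ‖A‖`. -/
theorem one_le_minorSumLE (q : ℕ) (B : Matrix (Fin p) (Fin p) ℝ) : 1 ≤ minorSumLE q B := by
  rw [← minorSum_zero B]
  exact Finset.single_le_sum (f := fun j => minorSum j B) (fun j _ => minorSum_nonneg j B)
    (by simp)

theorem minorSumLE_mul_le (q : ℕ) (A B : Matrix (Fin p) (Fin p) ℝ) :
    minorSumLE q (A * B) ≤ minorSumLE q A * minorSumLE q B := by
  unfold minorSumLE
  rw [Finset.sum_mul]
  refine Finset.sum_le_sum fun j hj => (minorSum_mul_le j A B).trans ?_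
  exact mul_le_mul_of_nonneg_left (Finset.single_le_sum (f := fun j => minorSum j B)
    (fun j _ => minorSum_nonneg j B) hj) (minorSum_nonneg j A)

theorem minorSumLE_le_of_entry_le (q : ℕ) {B : Matrix (Fin p) (Fin p) ℝ} {c : ℝ} (hc : 1 ≤ c)
    (h : ∀ i k, |B i k| ≤ c) :
    minorSumLE q B ≤
      (∑ j ∈ Finset.range (q + 1), (p : ℝ) ^ j * ((p : ℝ) ^ j * j.factorial)) * c ^ q := by
  unfold minorSumLE
  rw [Finset.sum_mul]
  refine Finset.sum_le_sum fun j hj => (minorSum_le_of_entry_le j h).trans ?_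
  have : c ^ j ≤ c ^ q := pow_le_pow_right₀ hc (by simpa [Nat.lt_succ_iff] using hj)
  calc (p : ℝ) ^ j * ((p : ℝ) ^ j * (j.factorial * c ^ j))
      = (p : ℝ) ^ j * ((p : ℝ) ^ j * j.factorial) * c ^ j := by ring
    _ ≤ _ := by gcongr

/-- The product of the numbers `max 1 (σ i)` with `i < q`. -/
def initialProd (q : ℕ) (σ : Fin p → ℝ) : ℝ :=
  ∏ i ∈ Finset.univ.filter (fun i : Fin p => i.val < q), max 1 (σ i)

/-- The product is itself a principal minor, taken on the indices `i < q` with `σ i > 1`. -/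
theorem initialProd_le_minorSumLE_diagonal (q : ℕ) (σ : Fin p → ℝ) :
    initialProd q σ ≤ minorSumLE q (diagonal σ) := by
  set s := Finset.univ.filter (fun i : Fin p => i.val < q ∧ 1 < σ i) with hs
  have h1 : initialProd q σ = ∏ i ∈ s, σ i := by
    rw [initialProd, hs, ← Finset.filter_filter, Finset.prod_filter (fun i => 1 < σ i)]
    refine Finset.prod_congr rfl fun i _ => ?_
    split_ifs with h
    · exact max_eq_right h.le
    · exact max_eq_left (not_lt.1 h)
  have hcard : s.card ≤ q := by
    have : (s.map Fin.valEmbedding) ⊆ Finset.range q := by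
      intro x hx
      simp only [hs, Finset.mem_map, Finset.mem_filter] at hx
      obtain ⟨i, hi, rfl⟩ := hx
      exact Finset.mem_range.2 hi.2.1
    simpa using Finset.card_le_card this
  have h2 : ∏ i ∈ s, σ i = ((diagonal σ).submatrix (s.orderEmbOfFin rfl)
      (s.orderEmbOfFin rfl)).det := by
    rw [submatrix_diagonal _ _ (s.orderEmbOfFin rfl).injective, det_diagonal]
    conv_lhs => rw [← Finset.image_orderEmbOfFin_univ s rfl,
      Finset.prod_image (s.orderEmbOfFin rfl).injective.injOn]
    rfl
  rw [h1, h2]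
  calc _ ≤ minorSum s.card (diagonal σ) :=
        (le_abs_self _).trans (abs_det_submatrix_le s.card (diagonal σ) _ _)
    _ ≤ minorSumLE q (diagonal σ) :=
        Finset.single_le_sum (f := fun j => minorSum j (diagonal σ))
          (fun j _ => minorSum_nonneg j _) (by simpa [Nat.lt_succ_iff] using hcard)

/-- For a nonincreasing sequence, a product of at most `q` values at distinct places is at most the
product of the first `q` values truncated below by `1`. -/
theorem prod_injective_le_initialProd {j q : ℕ} (hjq : j ≤ q) {σ : Fin p → ℝ} (hσ : Antitone σ)
    (h0 : ∀ i, 0 ≤ σ i) {f : Fin j → Fin p} (hf : Function.Injective f) :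
    ∏ i, σ (f i) ≤ initialProd q σ := by
  set s := Finset.univ.image f with hs
  have hcard : s.card = j := by rw [hs, Finset.card_image_of_injective _ hf]; simp
  have h1 : ∏ i, σ (f i) = ∏ i : Fin j, σ (s.orderEmbOfFin hcard i) := by
    rw [← Finset.prod_image (f := σ) (s := Finset.univ) (g := f) hf.injOn, ← hs]
    conv_lhs => rw [← Finset.image_orderEmbOfFin_univ s hcard,
      Finset.prod_image (s.orderEmbOfFin hcard).injective.injOn]
  have hjp : j ≤ p := by simpa [hcard] using s.card_le_univ
  have h2 : ∀ n (hn : n < j), n ≤ (s.orderEmbOfFin hcard ⟨n, hn⟩).val := by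
    intro n
    induction n with
    | zero => simp
    | succ n ih =>
      intro hn
      have h3 := ih (by omega)
      have h4 : s.orderEmbOfFin hcard ⟨n, by omega⟩ < s.orderEmbOfFin hcard ⟨n + 1, hn⟩ := by
        rw [OrderEmbedding.lt_iff_lt]; simp
      have := Fin.lt_def.1 h4
      omega
  rw [h1]
  calc ∏ i : Fin j, σ (s.orderEmbOfFin hcard i)
      ≤ ∏ i : Fin j, max 1 (σ (Fin.castLE hjp i)) :=
        Finset.prod_le_prod (fun i _ => h0 _) fun i _ =>
          (hσ (Fin.le_def.2 (h2 i.val i.isLt))).trans (le_max_right _ _)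
    _ = ∏ i ∈ Finset.univ.image (Fin.castLE hjp), max 1 (σ i) := by
        rw [Finset.prod_image (Fin.castLE_injective hjp).injOn]
    _ ≤ initialProd q σ := by
        refine Finset.prod_le_prod_of_subset_of_one_le ?_ (fun i _ => by positivity)
          (fun i _ _ => le_max_left _ _)
        intro i hi
        simp only [Finset.mem_image, Finset.mem_univ, true_and] at hi
        obtain ⟨k, rfl⟩ := hi
        simp only [Finset.mem_filter, Finset.mem_univ, true_and, Fin.val_castLE]
        omega

/-- A minor with a repeated column vanishes. Otherwise each Leibniz term is at most a product of
values of `σ` at distinct places. -/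
theorem minorSumLE_diagonal_le (q : ℕ) {σ : Fin p → ℝ} (hσ : Antitone σ) (h0 : ∀ i, 0 ≤ σ i) :
    minorSumLE q (diagonal σ) ≤
      (∑ j ∈ Finset.range (q + 1), (p : ℝ) ^ j * ((p : ℝ) ^ j * j.factorial)) *
        initialProd q σ := by
  have hQ : 0 ≤ initialProd q σ := Finset.prod_nonneg fun i _ => by positivity
  unfold minorSumLE
  rw [Finset.sum_mul]
  refine Finset.sum_le_sum fun j hj => ?_
  have hjq : j ≤ q := by simpa [Nat.lt_succ_iff] using hj
  have h1 : ∀ f g : Fin j → Fin p, |((diagonal σ).submatrix f g).det| ≤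
      j.factorial * initialProd q σ := fun f g => by
    by_cases hg : Function.Injective g
    · rw [det_apply']
      refine (Finset.abs_sum_le_sum_abs _ _).trans ?_
      calc _ ≤ ∑ π : Equiv.Perm (Fin j), initialProd q σ := by
            refine Finset.sum_le_sum fun π _ => ?_
            rw [abs_mul, Finset.abs_prod]
            have : |((Equiv.Perm.sign π : ℤ) : ℝ)| = 1 := by
              rcases Int.units_eq_one_or (Equiv.Perm.sign π) with h | h <;> simp [h]
            rw [this, one_mul]
            refine le_trans (Finset.prod_le_prod (fun _ _ => abs_nonneg _) fun i _ => ?_)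
              (prod_injective_le_initialProd hjq hσ h0 hg)
            rw [submatrix_apply, diagonal_apply]
            split_ifs with h
            · rw [h, abs_of_nonneg (h0 _)]
            · simpa using h0 _
        _ = _ := by simp [Finset.card_univ, Fintype.card_perm]
    · obtain ⟨a, b, hab, hne⟩ : ∃ a b, g a = g b ∧ a ≠ b := by
        simpa [Function.Injective] using hg
      rw [det_zero_of_column_eq hne (fun i => by simp [hab]), abs_zero]
      positivity
  calc minorSum j (diagonal σ)
      ≤ ∑ f : Fin j → Fin p, ∑ g : Fin j → Fin p, (j.factorial * initialProd q σ : ℝ) :=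
        Finset.sum_le_sum fun f _ => Finset.sum_le_sum fun g _ => h1 f g
    _ = _ := by simp; ring

end Matrix

/-! ### Singular values and their comparison with minors. -/

/-- The singular value decomposition of an invertible matrix. -/
theorem exists_singular_bases {p : ℕ} (B : GL (Fin p) ℝ) :
    ∃ (e f : OrthonormalBasis (Fin p) ℝ (EuclideanSpace ℝ (Fin p))) (σ : Fin p → ℝ),
      Antitone σ ∧ (∀ i, 0 < σ i) ∧ ∀ i, euclideanOp B (e i) = σ i • f i := by
  set S : EuclideanSpace ℝ (Fin p) →ₗ[ℝ] EuclideanSpace ℝ (Fin p) := (euclideanOp B).toLinearMap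
  have hp : Module.finrank ℝ (EuclideanSpace ℝ (Fin p)) = p := by simp
  have hinj : Function.Injective S := by
    have h : euclideanOp B⁻¹ * euclideanOp B = 1 := by
      simp only [euclideanOp, ← map_mul, ← Units.val_mul, inv_mul_cancel, Units.val_one, map_one]
    intro x y hxy
    have h1 : euclideanOp B x = euclideanOp B y := hxy
    have h2 := congrArg (euclideanOp B⁻¹) h1
    rw [← mul_apply_eq_comp, ← mul_apply_eq_comp, h] at h2
    simpa using h2
  -- In this basis the Gram operator of `S` is diagonal, so the vectors `S (e i)` are orthogonal of
  -- lengths `σ i`; normalised, they give the second basis.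
  set e := S.isSymmetric_adjoint_comp_self.eigenvectorBasis hp with he
  set σ : Fin p → ℝ := fun i => S.singularValues i with hσ
  have hpos : ∀ i, 0 < σ i := fun i =>
    (S.injective_iff_forall_lt_finrank_singularValues_pos.1 hinj) i (by simp)
  have hgram : ∀ i j, inner ℝ (S (e i)) (S (e j)) = σ j ^ 2 * inner ℝ (e i) (e j) := by
    intro i j
    have h1 := S.isSymmetric_adjoint_comp_self.apply_eigenvectorBasis hp j
    rw [← S.sq_singularValues_fin hp] at h1
    rw [← LinearMap.adjoint_inner_right, ← LinearMap.comp_apply, h1, inner_smul_right]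
    simp [hσ, he]
  have hon : Orthonormal ℝ (fun i => (σ i)⁻¹ • S (e i)) := by
    rw [orthonormal_iff_ite]
    intro i j
    rw [inner_smul_left, inner_smul_right, hgram, orthonormal_iff_ite.1 e.orthonormal]
    split_ifs with h
    · subst h
      have := (hpos i).ne'
      simp only [conj_trivial]
      field_simp
    · simp
  have hspan := hon.linearIndependent.span_eq_top_of_card_eq_finrank' (by simp)
  refine ⟨e, OrthonormalBasis.mk hon hspan.ge, σ, fun i j hij => S.singularValues_antitone hij, hpos, fun i => ?_⟩
  rw [OrthonormalBasis.coe_mk, smul_smul, mul_inv_cancel₀ (hpos i).ne', one_smul]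
  rfl

/-- The product of the large singular values is comparable to the sum of the minors. -/
theorem exists_initialProd_comparable (p q : ℕ) : ∃ C : ℝ, 1 ≤ C ∧ ∀ (B : GL (Fin p) ℝ)
    (e f : OrthonormalBasis (Fin p) ℝ (EuclideanSpace ℝ (Fin p))) (σ : Fin p → ℝ), Antitone σ →
      (∀ i, 0 < σ i) → (∀ i, euclideanOp B (e i) = σ i • f i) →
      Matrix.initialProd q σ ≤ C * Matrix.minorSumLE q (B : Matrix (Fin p) (Fin p) ℝ) ∧
      Matrix.minorSumLE q (B : Matrix (Fin p) (Fin p) ℝ) ≤ C * Matrix.initialProd q σ := by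
  -- `D` bounds `minorSumLE` for matrices with entries at most `1`, in particular orthogonal ones.
  -- The cube covers two orthogonal factors and one diagonal factor.
  set D : ℝ := ∑ j ∈ Finset.range (q + 1), (p : ℝ) ^ j * ((p : ℝ) ^ j * j.factorial) with hD
  have hD1 : 1 ≤ D := by
    have := Finset.single_le_sum (f := fun j => (p : ℝ) ^ j * ((p : ℝ) ^ j * j.factorial))
      (fun j _ => by positivity) (Finset.mem_range.2 (Nat.succ_pos q))
    simpa using this
  refine ⟨D ^ 3, one_le_pow₀ hD1, fun B e f σ hσ hpos hB => ?_⟩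
  have hQ : 0 ≤ Matrix.initialProd q σ := Finset.prod_nonneg fun i _ => by positivity
  have hM : 0 ≤ Matrix.minorSumLE q (B : Matrix (Fin p) (Fin p) ℝ) :=
    zero_le_one.trans (Matrix.one_le_minorSumLE _ _)
  have hentry : ∀ (b : OrthonormalBasis (Fin p) ℝ (EuclideanSpace ℝ (Fin p))) i k, |b k i| ≤ 1 := by
    intro b i k
    have := PiLp.norm_apply_le (b k) i
    rw [b.norm_eq_one] at this
    simpa using this
  set M : OrthonormalBasis (Fin p) ℝ (EuclideanSpace ℝ (Fin p)) → Matrix (Fin p) (Fin p) ℝ :=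
    fun b => Matrix.of fun i k => b k i with hMdef
  have hMle : ∀ b, Matrix.minorSumLE q (M b) ≤ D := fun b => by
    simpa using Matrix.minorSumLE_le_of_entry_le q le_rfl (B := M b) (fun i k => hentry b i k)
  have hMTle : ∀ b, Matrix.minorSumLE q (M b).transpose ≤ D := fun b => by
    simpa using Matrix.minorSumLE_le_of_entry_le q le_rfl (B := (M b).transpose)
      (fun i k => hentry b k i)
  have hMT : ∀ b, (M b).transpose * M b = 1 := fun b => by
    ext i k
    rw [Matrix.mul_apply, Matrix.one_apply, ← orthonormal_iff_ite.1 b.orthonormal i k]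
    simp [hMdef, PiLp.inner_apply, mul_comm]
  have hMT' : ∀ b, M b * (M b).transpose = 1 := fun b => mul_eq_one_comm.1 (hMT b)
  have hBe : (B : Matrix (Fin p) (Fin p) ℝ) * M e = M f * Matrix.diagonal σ := by
    ext i k
    have h := congrArg (fun v : EuclideanSpace ℝ (Fin p) => v i) (hB k)
    rw [Matrix.mul_diagonal, Matrix.mul_apply]
    simp only [euclideanOp, Matrix.toEuclideanCLM, PiLp.smul_apply, smul_eq_mul] at h
    rw [hMdef]
    simp only [Matrix.of_apply]
    rw [mul_comm, ← h]
    rfl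
  have h1 : Matrix.diagonal σ = (M f).transpose * ((B : Matrix (Fin p) (Fin p) ℝ) * M e) := by
    rw [hBe, ← mul_assoc, hMT, one_mul]
  have h2 : (B : Matrix (Fin p) (Fin p) ℝ) = M f * (Matrix.diagonal σ * (M e).transpose) := by
    rw [← mul_assoc, ← hBe, mul_assoc, hMT', mul_one]
  have hnn : ∀ B : Matrix (Fin p) (Fin p) ℝ, 0 ≤ Matrix.minorSumLE q B := fun B =>
    zero_le_one.trans (Matrix.one_le_minorSumLE _ _)
  have hD0 : 0 ≤ D := zero_le_one.trans hD1
  constructor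
  · calc Matrix.initialProd q σ ≤ Matrix.minorSumLE q (Matrix.diagonal σ) :=
          Matrix.initialProd_le_minorSumLE_diagonal q σ
      _ ≤ D * (Matrix.minorSumLE q (B : Matrix (Fin p) (Fin p) ℝ) * D) := by
          rw [h1]
          refine (Matrix.minorSumLE_mul_le _ _ _).trans ?_
          refine mul_le_mul (hMTle f) ?_ (hnn _) hD0
          refine (Matrix.minorSumLE_mul_le _ _ _).trans ?_
          exact mul_le_mul_of_nonneg_left (hMle e) hM
      _ = D ^ 2 * Matrix.minorSumLE q (B : Matrix (Fin p) (Fin p) ℝ) := by ring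
      _ ≤ _ := mul_le_mul_of_nonneg_right (pow_le_pow_right₀ hD1 (by norm_num)) hM
  · calc Matrix.minorSumLE q (B : Matrix (Fin p) (Fin p) ℝ)
        ≤ D * (D * Matrix.initialProd q σ * D) := by
          rw [h2]
          refine (Matrix.minorSumLE_mul_le _ _ _).trans ?_
          refine mul_le_mul (hMle f) ?_ (hnn _) hD0
          refine (Matrix.minorSumLE_mul_le _ _ _).trans ?_
          exact mul_le_mul (Matrix.minorSumLE_diagonal_le q hσ fun i => (hpos i).le) (hMTle e)
            (hnn _) (mul_nonneg hD0 hQ)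
      _ = _ := by ring

/-! ### Rotation of the singular bases in time. -/

/-- A constant factor is absorbed by an arbitrarily small exponential rate. -/
theorem eventually_const_mul_exp_le (C : ℝ) {a ε : ℝ} (h : a < ε) :
    ∀ᶠ n : ℕ in atTop, C * Real.exp (n * a) ≤ Real.exp (n * ε) := by
  have h1 : Tendsto (fun n : ℕ => Real.exp (n * (ε - a))) atTop atTop :=
    Real.tendsto_exp_atTop.comp (tendsto_natCast_atTop_atTop.atTop_mul_const (sub_pos.2 h))
  filter_upwards [h1.eventually_ge_atTop C] with n hn
  calc C * Real.exp (n * a) ≤ Real.exp (n * (ε - a)) * Real.exp (n * a) := by gcongr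
    _ = Real.exp (n * ε) := by rw [← Real.exp_add]; ring_nf

/-- A sequence of operators with singular values `σ n i` of exponential rates `τ i` (truncated below
by `0`), whose consecutive terms differ by subexponential factors. -/
structure SingularFlow {p : ℕ}
    (A : ℕ → EuclideanSpace ℝ (Fin p) →L[ℝ] EuclideanSpace ℝ (Fin p))
    (e f : ℕ → OrthonormalBasis (Fin p) ℝ (EuclideanSpace ℝ (Fin p)))
    (σ : ℕ → Fin p → ℝ) (τ : Fin p → ℝ) : Prop where
  apply_basis : ∀ n i, A n (e n i) = σ n i • f n i
  pos : ∀ n i, 0 < σ n i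
  rate_nonneg : ∀ i, 0 ≤ τ i
  tendsto : ∀ i, Tendsto (fun n : ℕ => Real.log (max 1 (σ n i)) / n) atTop (𝓝 (τ i))
  step : ∀ ε : ℝ, 0 < ε → ∀ᶠ n : ℕ in atTop, ∀ v, ‖A (n + 1) v‖ ≤ Real.exp (n * ε) * ‖A n v‖

namespace SingularFlow

variable {p : ℕ} {A : ℕ → EuclideanSpace ℝ (Fin p) →L[ℝ] EuclideanSpace ℝ (Fin p)}
  {e f : ℕ → OrthonormalBasis (Fin p) ℝ (EuclideanSpace ℝ (Fin p))}
  {σ : ℕ → Fin p → ℝ} {τ : Fin p → ℝ}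

theorem eventually_max_le (h : SingularFlow A e f σ τ) {ε : ℝ} (hε : 0 < ε) :
    ∀ᶠ n : ℕ in atTop, ∀ i, max 1 (σ n i) ≤ Real.exp (n * (τ i + ε)) := by
  refine eventually_all.2 fun i => ?_
  filter_upwards [(h.tendsto i).eventually (gt_mem_nhds (lt_add_of_pos_right _ hε)),
    eventually_gt_atTop 0] with n hn hn0
  have hn' : (0 : ℝ) < n := by exact_mod_cast hn0
  rw [div_lt_iff₀ hn', mul_comm] at hn
  have hpos : 0 < max 1 (σ n i) := lt_max_of_lt_left one_pos
  rw [← Real.log_le_iff_le_exp hpos]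
  exact hn.le

theorem eventually_le_max (h : SingularFlow A e f σ τ) {ε : ℝ} (hε : 0 < ε) :
    ∀ᶠ n : ℕ in atTop, ∀ i, Real.exp (n * (τ i - ε)) ≤ max 1 (σ n i) := by
  refine eventually_all.2 fun i => ?_
  filter_upwards [(h.tendsto i).eventually (lt_mem_nhds (sub_lt_self _ hε)),
    eventually_gt_atTop 0] with n hn hn0
  have hn' : (0 : ℝ) < n := by exact_mod_cast hn0
  rw [lt_div_iff₀ hn', mul_comm] at hn
  have hpos : 0 < max 1 (σ n i) := lt_max_of_lt_left one_pos
  rw [← Real.le_log_iff_exp_le hpos]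
  exact hn.le

theorem apply_eq_sum (h : SingularFlow A e f σ τ) (n : ℕ) (v : EuclideanSpace ℝ (Fin p)) :
    A n v = ∑ i, (inner ℝ (e n i) v * σ n i) • f n i := by
  conv_lhs => rw [← (e n).sum_repr' v]
  simp [map_sum, h.apply_basis, smul_smul]

theorem mul_abs_inner_le (h : SingularFlow A e f σ τ) (n : ℕ) (v : EuclideanSpace ℝ (Fin p))
    (i : Fin p) : σ n i * |inner ℝ (e n i) v| ≤ ‖A n v‖ := by
  have h1 : inner ℝ (f n i) (A n v) = inner ℝ (e n i) v * σ n i := by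
    rw [h.apply_eq_sum, inner_sum]
    simp [inner_smul_right, orthonormal_iff_ite.1 (f n).orthonormal]
  have h2 := abs_real_inner_le_norm (f n i) (A n v)
  rw [h1, abs_mul, abs_of_pos (h.pos n i), (f n).norm_eq_one, one_mul] at h2
  linarith

theorem norm_apply_le_sum (h : SingularFlow A e f σ τ) (n : ℕ) (v : EuclideanSpace ℝ (Fin p)) :
    ‖A n v‖ ≤ ∑ i, σ n i * |inner ℝ (e n i) v| := by
  rw [h.apply_eq_sum]
  refine (norm_sum_le _ _).trans (Finset.sum_le_sum fun i _ => ?_)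
  rw [norm_smul, (f n).norm_eq_one, mul_one, Real.norm_eq_abs, abs_mul, abs_of_pos (h.pos n i),
    mul_comm]

theorem _root_.OrthonormalBasis.abs_inner_le {p : ℕ}
    (b : OrthonormalBasis (Fin p) ℝ (EuclideanSpace ℝ (Fin p)))
    (v : EuclideanSpace ℝ (Fin p)) (i : Fin p) : |inner ℝ (b i) v| ≤ ‖v‖ := by
  have := abs_real_inner_le_norm (b i) v
  rwa [b.norm_eq_one, one_mul] at this

theorem abs_inner_basis_le (m n : ℕ) (i j : Fin p) : |inner ℝ (e m i) (e n j)| ≤ 1 := by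
  simpa [(e n).norm_eq_one] using (e m).abs_inner_le (e n j) i

/-- Overlap of consecutive singular bases. -/
theorem eventually_abs_inner_succ_le (h : SingularFlow A e f σ τ) {ε : ℝ} (hε : 0 < ε) :
    ∀ᶠ n : ℕ in atTop, ∀ i j,
      |inner ℝ (e (n + 1) i) (e n j)| ≤ Real.exp (-(n * (τ i - τ j - ε))) := by
  have hε4 : 0 < ε / 4 := by linarith
  filter_upwards [h.eventually_max_le hε4,
    (tendsto_add_atTop_nat 1).eventually (h.eventually_le_max hε4), h.step _ hε4,
    eventually_ge_atTop 1] with n h1 h2 h3 hn i j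
  have hn1 : (1 : ℝ) ≤ n := by exact_mod_cast hn
  have h4 : Real.exp (n * (τ i - ε / 2)) ≤ max 1 (σ (n + 1) i) := by
    refine le_trans (Real.exp_le_exp.2 ?_) (h2 i)
    have := h.rate_nonneg i
    push_cast
    nlinarith
  rcases le_or_gt 1 (σ (n + 1) i) with h5 | h5
  · rw [max_eq_right h5] at h4
    have h6 := h.mul_abs_inner_le (n + 1) (e n j) i
    have h7 := h3 (e n j)
    rw [h.apply_basis, norm_smul, (f n).norm_eq_one, mul_one, Real.norm_eq_abs,
      abs_of_pos (h.pos n j)] at h7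
    have h8 : σ n j ≤ Real.exp (n * (τ j + ε / 4)) := (le_max_right _ _).trans (h1 j)
    have h9 : Real.exp (n * (τ i - ε / 2)) * |inner ℝ (e (n + 1) i) (e n j)| ≤
        Real.exp (n * (ε / 4)) * Real.exp (n * (τ j + ε / 4)) :=
      calc _ ≤ σ (n + 1) i * |inner ℝ (e (n + 1) i) (e n j)| := by gcongr
        _ ≤ _ := h6.trans (h7.trans (by gcongr))
    have h10 : |inner ℝ (e (n + 1) i) (e n j)| = Real.exp (-(n * (τ i - ε / 2))) *
        (Real.exp (n * (τ i - ε / 2)) * |inner ℝ (e (n + 1) i) (e n j)|) := by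
      rw [← mul_assoc, ← Real.exp_add, neg_add_cancel, Real.exp_zero, one_mul]
    rw [h10]
    refine (mul_le_mul_of_nonneg_left h9 (Real.exp_pos _).le).trans ?_
    rw [← Real.exp_add, ← Real.exp_add]
    exact Real.exp_le_exp.2 (by linarith)
  -- Where the truncation is active, `τ i ≤ ε / 2`, and the claimed bound is at least `1`.
  · rw [max_eq_left h5.le, Real.exp_le_one_iff] at h4
    refine (abs_inner_basis_le _ _ i j).trans (Real.one_le_exp ?_)
    have := h.rate_nonneg j
    nlinarith

/-- The component of `u` along the singular vectors at time `m` of rate at least `t`. -/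
noncomputable def fastPart (e : ℕ → OrthonormalBasis (Fin p) ℝ (EuclideanSpace ℝ (Fin p)))
    (τ : Fin p → ℝ) (t : ℝ) (m : ℕ) :
    EuclideanSpace ℝ (Fin p) →ₗ[ℝ] EuclideanSpace ℝ (Fin p) :=
  ∑ i ∈ Finset.univ.filter (fun i => t ≤ τ i), (innerₛₗ ℝ (e m i)).smulRight (e m i)

theorem fastPart_apply (t : ℝ) (m : ℕ) (u : EuclideanSpace ℝ (Fin p)) :
    fastPart e τ t m u =
      ∑ i ∈ Finset.univ.filter (fun i => t ≤ τ i), (inner ℝ (e m i) u : ℝ) • e m i := by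
  simp [fastPart, LinearMap.sum_apply]

theorem inner_fastPart (t : ℝ) (m : ℕ) (u : EuclideanSpace ℝ (Fin p)) (i : Fin p) :
    inner ℝ (e m i) (fastPart e τ t m u) = if t ≤ τ i then inner ℝ (e m i) u else 0 := by
  rw [fastPart_apply, inner_sum]
  simp [inner_smul_right, orthonormal_iff_ite.1 (e m).orthonormal]

theorem norm_fastPart_le (t : ℝ) (m : ℕ) (u : EuclideanSpace ℝ (Fin p)) :
    ‖fastPart e τ t m u‖ ≤ ‖u‖ := by
  refine le_of_sq_le_sq ?_ (norm_nonneg _)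
  rw [← (e m).sum_sq_norm_inner_right, ← (e m).sum_sq_norm_inner_right u]
  refine Finset.sum_le_sum fun i _ => ?_
  rw [inner_fastPart]
  split_ifs
  · rfl
  · simp; positivity

theorem abs_inner_le_norm_fastPart {t : ℝ} (m : ℕ) (u : EuclideanSpace ℝ (Fin p)) {i : Fin p}
    (hi : t ≤ τ i) : |inner ℝ (e m i) u| ≤ ‖fastPart e τ t m u‖ := by
  have := (e m).abs_inner_le (fastPart e τ t m u) i
  rwa [inner_fastPart, if_pos hi] at this

theorem fastPart_add_sum (t : ℝ) (m : ℕ) (u : EuclideanSpace ℝ (Fin p)) :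
    u = fastPart e τ t m u +
      ∑ k ∈ Finset.univ.filter (fun k => ¬ t ≤ τ k), (inner ℝ (e m k) u : ℝ) • e m k := by
  rw [fastPart_apply, Finset.sum_filter_add_sum_filter_not, (e m).sum_repr' u]

/-- The fast component grows in one step at most by the contribution of the slower ones. -/
theorem norm_fastPart_succ_le {ε t : ℝ} {m : ℕ}
    (hm : ∀ i j, |inner ℝ (e (m + 1) i) (e m j)| ≤ Real.exp (-(m * (τ i - τ j - ε))))
    (u : EuclideanSpace ℝ (Fin p)) :
    ‖fastPart e τ t (m + 1) u‖ ≤ ‖fastPart e τ t m u‖ +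
      ∑ k ∈ Finset.univ.filter (fun k => ¬ t ≤ τ k),
        |inner ℝ (e m k) u| * (p * Real.exp (-(m * (t - τ k - ε)))) := by
  conv_lhs => rw [fastPart_add_sum (e := e) (τ := τ) t m u, map_add, map_sum]
  refine (norm_add_le _ _).trans (add_le_add (norm_fastPart_le _ _ _) ?_)
  refine (norm_sum_le _ _).trans (Finset.sum_le_sum fun k _ => ?_)
  rw [map_smul, norm_smul, Real.norm_eq_abs]
  refine mul_le_mul_of_nonneg_left ?_ (abs_nonneg _)
  rw [fastPart_apply]
  refine (norm_sum_le _ _).trans ?_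
  calc _ ≤ ∑ i ∈ Finset.univ.filter (fun i => t ≤ τ i), Real.exp (-(m * (t - τ k - ε))) := by
        refine Finset.sum_le_sum fun i hi => ?_
        rw [norm_smul, (e (m + 1)).norm_eq_one, mul_one, Real.norm_eq_abs]
        refine (hm i k).trans (Real.exp_le_exp.2 ?_)
        have := (Finset.mem_filter.1 hi).2
        have : (m : ℝ) * t ≤ m * τ i := by gcongr
        linarith
    _ ≤ _ := by
        rw [Finset.sum_const, nsmul_eq_mul]
        gcongr
        exact (Finset.card_le_univ _).trans (by simp)

/-- A slow singular vector has small fast components at all later times. -/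
theorem eventually_norm_fastPart_le (h : SingularFlow A e f σ τ) (i : Fin p) :
    ∀ ε : ℝ, 0 < ε → ∀ᶠ n : ℕ in atTop, ∀ m ≥ n, ∀ j,
      ‖fastPart e τ (τ i) m (e n j)‖ ≤ Real.exp (-(n * (τ i - τ j - ε))) := by
  -- Induction on the rate: mass reaching the rates at least `τ i` comes from strictly slower
  -- indices, already controlled.
  have wf : WellFounded (fun i k : Fin p => τ i < τ k) :=
    Finite.wellFounded_of_trans_of_irrefl _
  induction i using wf.induction with
  | _ i ih =>
  intro ε hε
  obtain ⟨η, hη, hη0⟩ : ∃ η : ℝ, (∀ k, τ k < τ i → η ≤ τ i - τ k) ∧ 0 < η := by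
    have h1 : ∀ᶠ η : ℝ in 𝓝[>] 0, ∀ k, τ k < τ i → η ≤ τ i - τ k := by
      refine eventually_all.2 fun k => ?_
      by_cases hk : τ k < τ i
      · filter_upwards [(gt_mem_nhds (sub_pos.2 hk)).filter_mono nhdsWithin_le_nhds] with η hη _
        exact hη.le
      · exact Eventually.of_forall fun _ h' => absurd h' hk
    exact (h1.and self_mem_nhdsWithin).exists
  -- With `δ ≤ η / 2` every rate gap still exceeds `δ` by `η / 2`, which gives the ratio `r`; with
  -- `δ ≤ ε / 4` the total loss `2 * δ` stays below `ε`.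
  set δ := min (η / 2) (ε / 4) with hδ
  have hδ0 : 0 < δ := lt_min (by linarith) (by linarith)
  have hδη : δ ≤ η / 2 := min_le_left _ _
  have hδε : δ ≤ ε / 4 := min_le_right _ _
  set r := Real.exp (-(η / 2)) with hr
  have hr1 : r < 1 := by rw [hr, Real.exp_lt_one_iff]; linarith
  have hr0 : 0 < r := Real.exp_pos _
  have ih' : ∀ᶠ n : ℕ in atTop, ∀ k, τ k < τ i → ∀ m ≥ n, ∀ j,
      ‖fastPart e τ (τ k) m (e n j)‖ ≤ Real.exp (-(n * (τ k - τ j - δ))) := by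
    refine eventually_all.2 fun k => ?_
    by_cases hk : τ k < τ i
    · filter_upwards [ih k hk δ hδ0] with n hn _ using hn
    · exact Eventually.of_forall fun _ h' => absurd h' hk
  obtain ⟨n0, hn0⟩ := eventually_atTop.1 (h.eventually_abs_inner_succ_le hδ0)
  filter_upwards [ih', eventually_ge_atTop n0,
    eventually_const_mul_exp_le ((p : ℝ) * p / (1 - r)) (show 2 * δ < ε by linarith)]
    with n hn hnn0 hC m hm j
  rcases le_or_gt (τ i) (τ j) with hij | hij
  · refine (norm_fastPart_le _ _ _).trans ?_
    rw [(e n).norm_eq_one]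
    refine Real.one_le_exp ?_
    have : (0 : ℝ) ≤ n := by positivity
    nlinarith
  set Y := (p : ℝ) * p * Real.exp (-(n * (τ i - τ j - 2 * δ))) with hY
  -- At time `n + l` a slower index `k` carries at most `exp (-(n * (τ k - τ j - δ)))` and leaks a
  -- factor `exp (-((n + l) * (τ i - τ k - δ)))`. In the product `τ k` cancels from the `n` part,
  -- and the rest decays like `r ^ l`.
  have key : ∀ l : ℕ, ‖fastPart e τ (τ i) (n + l) (e n j)‖ ≤ Y * ∑ s ∈ Finset.range l, r ^ s := by
    intro l
    induction l with
    | zero =>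
      simp only [add_zero, Finset.range_zero, Finset.sum_empty, mul_zero]
      rw [fastPart_apply, Finset.sum_eq_zero, norm_zero]
      intro k hk
      have hk2 := (Finset.mem_filter.1 hk).2
      rw [orthonormal_iff_ite.1 (e n).orthonormal, if_neg, zero_smul]
      rintro rfl
      linarith
    | succ l ihl =>
      refine (norm_fastPart_succ_le (hn0 (n + l) (by omega)) _).trans ?_
      rw [Finset.sum_range_succ, mul_add]
      refine add_le_add ihl ?_
      calc _ ≤ ∑ k ∈ Finset.univ.filter (fun k => ¬ τ i ≤ τ k),
            p * Real.exp (-(n * (τ i - τ j - 2 * δ))) * r ^ l := by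
            refine Finset.sum_le_sum fun k hk => ?_
            have hk2 := not_le.1 (Finset.mem_filter.1 hk).2
            have h1 := (abs_inner_le_norm_fastPart (e := e) (n + l) (e n j) le_rfl).trans
              (hn k hk2 (n + l) (by omega) j)
            calc _ ≤ Real.exp (-(n * (τ k - τ j - δ))) *
                  (p * Real.exp (-(((n + l : ℕ) : ℝ) * (τ i - τ k - δ)))) := by gcongr
              _ = p * Real.exp (-(n * (τ i - τ j - 2 * δ)) + -(l * (τ i - τ k - δ))) := by
                  rw [mul_left_comm, ← Real.exp_add]
                  congr 2
                  push_cast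
                  ring
              _ ≤ p * Real.exp (-(n * (τ i - τ j - 2 * δ)) + l * (-(η / 2))) := by
                  gcongr
                  have := hη k hk2
                  have : (l : ℝ) * (η / 2) ≤ l * (τ i - τ k - δ) := by
                    gcongr
                    linarith
                  linarith
              _ = _ := by rw [Real.exp_add, Real.exp_nat_mul, hr, mul_assoc]
        _ ≤ _ := by
            rw [Finset.sum_const, nsmul_eq_mul, hY]
            have : ((Finset.univ.filter (fun k => ¬ τ i ≤ τ k)).card : ℝ) ≤ p := by
              exact_mod_cast (Finset.card_le_univ _).trans (by simp)
            calc _ ≤ (p : ℝ) * (p * Real.exp (-(n * (τ i - τ j - 2 * δ))) * r ^ l) := by gcongr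
              _ = _ := by ring
  have hgeom : ∀ l : ℕ, ∑ s ∈ Finset.range l, r ^ s ≤ 1 / (1 - r) := fun l => by
    rw [geom_sum_eq hr1.ne, ← neg_div_neg_eq]
    have : 0 < r ^ l := by positivity
    gcongr <;> linarith
  obtain ⟨l, rfl⟩ := Nat.exists_eq_add_of_le hm
  calc _ ≤ Y * (1 / (1 - r)) := (key l).trans (by gcongr; exact hgeom l)
    _ = ((p : ℝ) * p / (1 - r) * Real.exp (n * (2 * δ))) * Real.exp (-(n * (τ i - τ j))) := by
        rw [hY]
        have : Real.exp (-(n * (τ i - τ j - 2 * δ))) =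
          Real.exp (n * (2 * δ)) * Real.exp (-(n * (τ i - τ j))) := by
          rw [← Real.exp_add]; congr 1; ring
        rw [this]; ring
    _ ≤ Real.exp (n * ε) * Real.exp (-(n * (τ i - τ j))) := by gcongr
    _ = _ := by rw [← Real.exp_add]; congr 1; ring

end SingularFlow

/-! ### Reversing triangular bounds by orthogonality. -/

/-- If a matrix with inverse `N` has determinant of absolute value `1`, the entries of `N` are
controlled by those of the matrix. -/
theorem Matrix.abs_entry_le_of_mul_eq_one {p : ℕ} {M N : Matrix (Fin p) (Fin p) ℝ} {c : ℝ}
    (hc : 1 ≤ c) (hM : ∀ i j, |M i j| ≤ c) (hMN : M * N = 1) (hdet : |M.det| = 1) (i j : Fin p) :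
    |N i j| ≤ p.factorial * c ^ p := by
  have h0 : IsUnit M.det := by
    rw [isUnit_iff_ne_zero]
    intro h
    simp [h] at hdet
  have hN : N = M⁻¹ := (Matrix.inv_eq_right_inv hMN).symm
  rw [hN, Matrix.inv_def, Matrix.smul_apply, Matrix.adjugate_apply, smul_eq_mul, abs_mul,
    Ring.inverse_eq_inv', abs_inv, hdet, inv_one, one_mul]
  have := Matrix.det_le (A := M.updateRow j (Pi.single i 1)) (abv := AbsoluteValue.abs) (x := c)
    (fun a b => by
      rw [AbsoluteValue.abs_apply, Matrix.updateRow_apply]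
      split_ifs
      · rw [Pi.single_apply]
        split_ifs <;> simp <;> linarith
      · exact hM a b)
  simpa using this

/-- Entrywise bounds of triangular type on the transition matrix of two orthonormal bases are
symmetric, up to a power. -/
theorem OrthonormalBasis.abs_inner_le_of_weighted {p : ℕ}
    (b b' : OrthonormalBasis (Fin p) ℝ (EuclideanSpace ℝ (Fin p))) (w : Fin p → ℝ) {c : ℝ}
    (hc : 0 ≤ c) (h : ∀ i j, |inner ℝ (b i) (b' j)| ≤ Real.exp (-(w i - w j - c))) (i j : Fin p) :
    |inner ℝ (b i) (b' j)| ≤ p.factorial * Real.exp (-(w j - w i - p * c)) := by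
  set S : Matrix (Fin p) (Fin p) ℝ := Matrix.of fun i j => inner ℝ (b i) (b' j) with hS
  have hSS : S * S.transpose = 1 := by
    ext i j
    rw [Matrix.mul_apply, Matrix.one_apply, ← orthonormal_iff_ite.1 b.orthonormal i j,
      ← b'.sum_inner_mul_inner (b i) (b j)]
    refine Finset.sum_congr rfl fun k _ => ?_
    simp [hS, real_inner_comm]
  set d : Fin p → ℝ := fun i => Real.exp (w i)
  set d' : Fin p → ℝ := fun i => Real.exp (-w i)
  have hdd : Matrix.diagonal d' * Matrix.diagonal d = 1 := by
    rw [Matrix.diagonal_mul_diagonal, ← Matrix.diagonal_one]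
    congr 1
    ext i
    simp [d, d', ← Real.exp_add]
  have hdd' : Matrix.diagonal d * Matrix.diagonal d' = 1 := mul_eq_one_comm.1 hdd
  -- Conjugation by the weights bounds all entries by `exp c` and keeps the determinant `±1`. The
  -- same conjugate of the transpose is the inverse, so Cramer's rule bounds its entries.
  set M := Matrix.diagonal d * S * Matrix.diagonal d' with hM
  set N := Matrix.diagonal d * S.transpose * Matrix.diagonal d' with hN
  have hMN : M * N = 1 := by
    calc M * N = Matrix.diagonal d * (S * (Matrix.diagonal d' * Matrix.diagonal d) * S.transpose) *
          Matrix.diagonal d' := by simp only [hM, hN, mul_assoc]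
      _ = 1 := by rw [hdd, mul_one, hSS, mul_one, hdd']
  have hdet : |M.det| = 1 := by
    have h1 : M.det = S.det := by
      rw [hM, Matrix.det_mul, Matrix.det_mul, mul_right_comm, ← Matrix.det_mul, hdd',
        Matrix.det_one, one_mul]
    have h2 : S.det * S.det = 1 := by
      have := congrArg Matrix.det hSS
      rwa [Matrix.det_mul, Matrix.det_transpose, Matrix.det_one] at this
    rw [h1]
    have h3 : |S.det| * |S.det| = 1 := by rw [← abs_mul, h2, abs_one]
    nlinarith [abs_nonneg S.det]
  have hentry : ∀ i j, |M i j| ≤ Real.exp c := fun i j => by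
    rw [hM, Matrix.mul_diagonal, Matrix.diagonal_mul]
    rw [abs_mul, abs_mul, abs_of_pos (Real.exp_pos _), abs_of_pos (Real.exp_pos _)]
    calc Real.exp (w i) * |S i j| * Real.exp (-w j)
        ≤ Real.exp (w i) * Real.exp (-(w i - w j - c)) * Real.exp (-w j) := by
          gcongr
          exact h i j
      _ = Real.exp c := by rw [← Real.exp_add, ← Real.exp_add]; congr 1; ring
  have key := Matrix.abs_entry_le_of_mul_eq_one (Real.one_le_exp hc) hentry hMN hdet j i
  rw [hN, Matrix.mul_diagonal, Matrix.diagonal_mul, abs_mul, abs_mul,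
    abs_of_pos (Real.exp_pos _), abs_of_pos (Real.exp_pos _), ← Real.exp_nat_mul] at key
  have h1 : |inner ℝ (b i) (b' j)| = Real.exp (-(w j - w i)) *
      (Real.exp (w j) * |S.transpose j i| * Real.exp (-w i)) := by
    have : Real.exp (-(w j - w i)) * (Real.exp (w j) * |S.transpose j i| * Real.exp (-w i)) =
      Real.exp (-(w j - w i) + w j + -w i) * |S.transpose j i| := by
      rw [Real.exp_add, Real.exp_add]; ring
    rw [this]
    have : -(w j - w i) + w j + -w i = 0 := by ring
    rw [this, Real.exp_zero, one_mul]
    rfl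
  rw [h1]
  calc _ ≤ Real.exp (-(w j - w i)) * (p.factorial * Real.exp (p * c)) := by gcongr
    _ = _ := by rw [mul_left_comm, ← Real.exp_add]; congr 2; ring

/-! ### Slow vectors and uniform expansion. -/

namespace SingularFlow

variable {p : ℕ} {A : ℕ → EuclideanSpace ℝ (Fin p) →L[ℝ] EuclideanSpace ℝ (Fin p)}
  {e f : ℕ → OrthonormalBasis (Fin p) ℝ (EuclideanSpace ℝ (Fin p))}
  {σ : ℕ → Fin p → ℝ} {τ : Fin p → ℝ}

/-- `eventually_norm_fastPart_le` makes fast vectors at time `m` nearly orthogonal to slow ones at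
time `n`. Inverting the transition matrix with weights `n * τ i` exchanges the roles; the losses
`p!` and `p * δ` are absorbed in `ε`. -/
theorem eventually_abs_inner_le (h : SingularFlow A e f σ τ) {ε : ℝ} (hε : 0 < ε) :
    ∀ᶠ n : ℕ in atTop, ∀ m ≥ n, ∀ i j,
      |inner ℝ (e m i) (e n j)| ≤ Real.exp (-(n * (τ j - τ i - ε))) := by
  set δ := ε / (p + 1) with hδ
  have hδ0 : 0 < δ := by positivity
  have hpδ : p * δ < ε := by
    have : ε = (p + 1) * δ := by rw [hδ]; field_simp
    linarith
  filter_upwards [eventually_all.2 fun i => h.eventually_norm_fastPart_le i δ hδ0,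
    eventually_const_mul_exp_le p.factorial hpδ] with n hn hC m hm i j
  have h1 := (e m).abs_inner_le_of_weighted (e n) (fun i => n * τ i) (c := n * δ) (by positivity)
    (fun i j => by
      refine (abs_inner_le_norm_fastPart m (e n j) (le_refl (τ i))).trans ((hn i m hm j).trans ?_)
      exact le_of_eq (by congr 1; ring)) i j
  refine h1.trans ?_
  calc _ = (p.factorial * Real.exp (n * (p * δ))) * Real.exp (-(n * (τ j - τ i))) := by
        rw [mul_assoc, ← Real.exp_add]; congr 2; ring
    _ ≤ Real.exp (n * ε) * Real.exp (-(n * (τ j - τ i))) := by gcongr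
    _ = _ := by rw [← Real.exp_add]; congr 1; ring

/-- The singular vectors of rate `0` at time `m` have grown subexponentially at all earlier times. -/
theorem eventually_norm_apply_slow_le (h : SingularFlow A e f σ τ) {ε : ℝ} (hε : 0 < ε) :
    ∀ᶠ n : ℕ in atTop, ∀ m ≥ n, ∀ i, τ i = 0 → ‖A n (e m i)‖ ≤ Real.exp (n * ε) := by
  have hε4 : 0 < ε / 4 := by linarith
  filter_upwards [h.eventually_abs_inner_le hε4, h.eventually_max_le hε4,
    eventually_const_mul_exp_le p (show ε / 2 < ε by linarith)] with n h1 h2 hC m hm i hi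
  refine (h.norm_apply_le_sum n _).trans (le_trans ?_ hC)
  calc _ ≤ ∑ j : Fin p, Real.exp (n * (ε / 2)) := by
        refine Finset.sum_le_sum fun j _ => ?_
        have h3 := h1 m hm i j
        rw [hi, real_inner_comm] at h3
        calc σ n j * |inner ℝ (e n j) (e m i)|
            ≤ Real.exp (n * (τ j + ε / 4)) * Real.exp (-(n * (τ j - 0 - ε / 4))) := by
              gcongr
              exact (le_max_right _ _).trans (h2 j)
          _ = _ := by rw [← Real.exp_add]; congr 1; ring
    _ = _ := by simp

/-- A subspace containing no nonzero vector of subexponential growth is expanded uniformly. -/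
theorem exists_uniform_growth (h : SingularFlow A e f σ τ)
    (G : Submodule ℝ (EuclideanSpace ℝ (Fin p)))
    (hG : ∀ v ∈ G, (∀ ε : ℝ, 0 < ε → ∀ᶠ n : ℕ in atTop, ‖A n v‖ ≤ Real.exp (n * ε)) → v = 0) :
    ∃ c : ℝ, 0 < c ∧ ∃ l : ℝ, 0 < l ∧ ∀ᶠ n : ℕ in atTop, ∀ v ∈ G,
      c * Real.exp (n * l) * ‖v‖ ≤ ‖A n v‖ := by
  -- Any positive number below half of every positive rate serves as the expansion rate.
  obtain ⟨l, hl, hl0⟩ : ∃ l : ℝ, (∀ i, 0 < τ i → 2 * l < τ i) ∧ 0 < l := by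
    have h1 : ∀ᶠ l : ℝ in 𝓝[>] 0, ∀ i, 0 < τ i → 2 * l < τ i := by
      refine eventually_all.2 fun i => ?_
      by_cases hi : 0 < τ i
      · filter_upwards [(gt_mem_nhds (half_pos hi)).filter_mono nhdsWithin_le_nhds] with l hl _
        linarith
      · exact Eventually.of_forall fun _ h' => absurd h' hi
    exact (h1.and self_mem_nhdsWithin).exists
  by_contra hcon
  have hbad : ∀ k : ℕ, ∃ n ≥ k, ∃ v ∈ G, ‖v‖ = 1 ∧
      ‖A n v‖ ≤ 1 / ((k : ℝ) + 1) * Real.exp (n * l) := by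
    intro k
    by_contra hk
    refine hcon ⟨1 / ((k : ℝ) + 1), by positivity, l, hl0, ?_⟩
    filter_upwards [eventually_ge_atTop k] with n hn v hv
    by_contra hlt
    rw [not_le] at hlt
    have hv0 : 0 < ‖v‖ := by
      rw [norm_pos_iff]
      rintro rfl
      simp at hlt
    refine hk ⟨n, hn, ‖v‖⁻¹ • v, G.smul_mem _ hv, ?_, ?_⟩
    · rw [norm_smul, norm_inv, norm_norm, inv_mul_cancel₀ hv0.ne']
    · rw [map_smul, norm_smul, norm_inv, norm_norm, inv_mul_le_iff₀ hv0]
      linarith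
  choose n hnk v hvG hv1 hvA using hbad
  have hcomp : IsCompact (Metric.sphere (0 : EuclideanSpace ℝ (Fin p)) 1 ∩ G) :=
    (isCompact_sphere _ _).inter_right G.closed_of_finiteDimensional
  obtain ⟨w, hw, φ, hφ, hlim⟩ := hcomp.tendsto_subseq (x := v)
    (fun k => ⟨by simpa using hv1 k, hvG k⟩)
  have hw1 : ‖w‖ = 1 := by simpa using hw.1
  refine absurd (hG w hw.2 fun ε hε => ?_) (fun h0 => by simp [h0] at hw1)
  have hφt : Tendsto (fun k => n (φ k)) atTop atTop :=
    tendsto_atTop_mono (fun k => (hnk (φ k))) hφ.tendsto_atTop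
  -- The component of `v k` along rate `0` at its own time `n k`; the discarded part tends to `0`
  -- along the subsequence.
  set u : ℕ → EuclideanSpace ℝ (Fin p) := fun k =>
    ∑ i ∈ Finset.univ.filter (fun i => τ i = 0), (inner ℝ (e (n k) i) (v k) : ℝ) • e (n k) i with hu
  have huv : Tendsto (fun k => u (φ k)) atTop (𝓝 w) := by
    have hdiff : ∀ᶠ k in atTop, ‖v (φ k) - u (φ k)‖ ≤ p * (1 / ((φ k : ℝ) + 1)) := by
      filter_upwards [hφt.eventually (h.eventually_le_max hl0),
        hφt.eventually (eventually_ge_atTop 1)] with k hk hk1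
      set m := n (φ k)
      have hm : (1 : ℝ) ≤ m := by exact_mod_cast hk1
      have h1 : v (φ k) - u (φ k) = ∑ i ∈ Finset.univ.filter (fun i => ¬ τ i = 0),
          (inner ℝ (e m i) (v (φ k)) : ℝ) • e m i := by
        rw [sub_eq_iff_eq_add', hu, Finset.sum_filter_add_sum_filter_not, (e m).sum_repr']
      rw [h1]
      refine (norm_sum_le _ _).trans ?_
      calc _ ≤ ∑ i ∈ Finset.univ.filter (fun i => ¬ τ i = 0), (1 / ((φ k : ℝ) + 1)) := by
            refine Finset.sum_le_sum fun i hi => ?_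
            have hτ : 0 < τ i :=
              lt_of_le_of_ne (h.rate_nonneg i) (Ne.symm (Finset.mem_filter.1 hi).2)
            rw [norm_smul, (e m).norm_eq_one, mul_one, Real.norm_eq_abs]
            have h2 := (h.mul_abs_inner_le m (v (φ k)) i).trans (hvA (φ k))
            -- Since `2 * l < τ i`, the truncated singular value exceeds `1`, so the true one is at
            -- least `exp (m * l)`, and the smallness of `A m` on `v (φ k)` bounds this coefficient.
            have h3 : Real.exp (m * l) ≤ Real.exp (m * (τ i - l)) := by
              gcongr
              linarith [hl i hτ]
            have h4 := h3.trans (hk i)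
            have h5 : 1 < Real.exp (m * l) := by
              rw [Real.one_lt_exp_iff]; positivity
            have h6 : Real.exp (m * l) ≤ σ m i := by
              rcases le_max_iff.1 h4 with h7 | h7
              · linarith
              · exact h7
            have h7 : Real.exp (m * l) * |inner ℝ (e m i) (v (φ k))| ≤
                Real.exp (m * l) * (1 / ((φ k : ℝ) + 1)) := by
              rw [mul_comm _ (1 / ((φ k : ℝ) + 1))]
              exact le_trans (by gcongr) h2
            exact le_of_mul_le_mul_left h7 (Real.exp_pos _)
        _ ≤ _ := by
            rw [Finset.sum_const, nsmul_eq_mul]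
            gcongr
            exact_mod_cast (Finset.card_le_univ _).trans (by simp)
    have h0 : Tendsto (fun k => (p : ℝ) * (1 / ((φ k : ℝ) + 1))) atTop (𝓝 0) := by
      have := (tendsto_one_div_add_atTop_nhds_zero_nat (𝕜 := ℝ)).comp hφ.tendsto_atTop
      simpa using this.const_mul (p : ℝ)
    have h1 := squeeze_zero_norm' hdiff h0
    simpa using hlim.sub h1
  have hε2 : 0 < ε / 2 := by linarith
  -- The time `N` is fixed while `n (φ k) → ∞`: the bound on slow vectors of all later times passes
  -- to the limit `w`.
  filter_upwards [h.eventually_norm_apply_slow_le hε2,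
    eventually_const_mul_exp_le p (show ε / 2 < ε by linarith)] with N hN hC
  have h1 : Tendsto (fun k => ‖A N (u (φ k))‖) atTop (𝓝 ‖A N w‖) :=
    (((A N).continuous.tendsto w).comp huv).norm
  refine le_of_tendsto h1 ?_
  filter_upwards [hφt.eventually (eventually_ge_atTop N)] with k hk
  refine le_trans ?_ hC
  rw [hu, map_sum]
  refine (norm_sum_le _ _).trans ?_
  calc _ ≤ ∑ i ∈ Finset.univ.filter (fun i => τ i = 0), Real.exp (N * (ε / 2)) := by
        refine Finset.sum_le_sum fun i hi => ?_
        rw [map_smul, norm_smul, Real.norm_eq_abs]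
        have h2 := (e (n (φ k))).abs_inner_le (v (φ k)) i
        rw [hv1] at h2
        calc _ ≤ 1 * Real.exp (N * (ε / 2)) := by
              gcongr
              exact hN _ hk i (Finset.mem_filter.1 hi).2
          _ = _ := one_mul _
    _ ≤ _ := by
        rw [Finset.sum_const, nsmul_eq_mul]
        gcongr
        exact_mod_cast (Finset.card_le_univ _).trans (by simp)

end SingularFlow

/-! ### Exponents of the cocycle and expansion of transverse subspaces. -/

section Cocycle

variable {p : ℕ}

theorem euclideanOp_mul_apply (B C : GL (Fin p) ℝ) (v : EuclideanSpace ℝ (Fin p)) :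
    euclideanOp (B * C) v = euclideanOp B (euclideanOp C v) := by
  simp only [euclideanOp, Units.val_mul, map_mul]
  rfl

theorem abs_entry_le_norm_euclideanOp (B : GL (Fin p) ℝ) (i k : Fin p) :
    |(B : Matrix (Fin p) (Fin p) ℝ) i k| ≤ ‖euclideanOp B‖ := by
  have h1 : euclideanOp B (EuclideanSpace.single k 1) i = (B : Matrix (Fin p) (Fin p) ℝ) i k := by
    change (Matrix.mulVec (B : Matrix (Fin p) (Fin p) ℝ) (Pi.single k 1)) i = _
    simp
  have h2 := PiLp.norm_apply_le (euclideanOp B (EuclideanSpace.single k 1)) i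
  rw [h1, Real.norm_eq_abs] at h2
  have h3 := (euclideanOp B).le_opNorm (EuclideanSpace.single k 1)
  simp only [PiLp.norm_single, norm_one, mul_one] at h3
  exact h2.trans h3

variable {Δ : Type*} {T : Δ → Δ} {A : Δ → GL (Fin p) ℝ}

theorem cocycleIter_add (m n : ℕ) (x : Δ) :
    cocycleIter T A (m + n) x = cocycleIter T A n (T^[m] x) * cocycleIter T A m x := by
  induction n with
  | zero => simp [cocycleIter]
  | succ n ih =>
    rw [← add_assoc, cocycleIter, ih, cocycleIter, ← mul_assoc, ← Function.iterate_add_apply,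
      add_comm m n]

theorem mem_centralStableSpace_of_eventually_le {x : Δ} {v : EuclideanSpace ℝ (Fin p)}
    (h : ∀ ε : ℝ, 0 < ε → ∀ᶠ n : ℕ in atTop,
      ‖euclideanOp (cocycleIter T A n x) v‖ ≤ Real.exp (n * ε)) :
    v ∈ centralStableSpace T A x := by
  change limsup (fun n : ℕ => ‖euclideanOp (cocycleIter T A n x) v‖ₑ ^ (1 / (n : ℝ))) atTop ≤ 1
  have h1 : ∀ ε : ℝ, 0 < ε →
      limsup (fun n : ℕ => ‖euclideanOp (cocycleIter T A n x) v‖ₑ ^ (1 / (n : ℝ))) atTop ≤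
        ENNReal.ofReal (Real.exp ε) := fun ε hε => by
    refine limsup_le_of_le (by isBoundedDefault) ?_
    filter_upwards [h ε hε, eventually_gt_atTop 0] with n hn hn0
    have hn' : (n : ℝ) ≠ 0 := by positivity
    rw [← ofReal_norm]
    calc _ ≤ ENNReal.ofReal (Real.exp (n * ε)) ^ (1 / (n : ℝ)) :=
          ENNReal.rpow_le_rpow (ENNReal.ofReal_le_ofReal hn) (by positivity)
      _ = ENNReal.ofReal (Real.exp ε) := by
          rw [ENNReal.ofReal_rpow_of_pos (Real.exp_pos _), ← Real.exp_mul]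
          congr 2
          field_simp
  have h2 : Tendsto (fun ε : ℝ => ENNReal.ofReal (Real.exp ε)) (𝓝[>] 0) (𝓝 1) := by
    have h3 : Continuous fun ε : ℝ => ENNReal.ofReal (Real.exp ε) :=
      ENNReal.continuous_ofReal.comp Real.continuous_exp
    have := h3.tendsto 0
    simp only [Real.exp_zero, ENNReal.ofReal_one] at this
    exact this.mono_left nhdsWithin_le_nhds
  exact ge_of_tendsto h2 (eventually_nhdsWithin_of_forall fun ε hε => h1 ε hε)

variable [MeasurableSpace Δ] {μ : Measure Δ}

theorem measurable_cocycleIter (hT : Measurable T)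
    (hA : ∀ i j, Measurable fun x => (A x : Matrix (Fin p) (Fin p) ℝ) i j) (n : ℕ) :
    ∀ i j, Measurable fun x => (cocycleIter T A n x : Matrix (Fin p) (Fin p) ℝ) i j := by
  induction n with
  | zero => intro i j; exact measurable_const
  | succ n ih =>
    intro i j
    simp only [cocycleIter, Units.val_mul, Matrix.mul_apply]
    exact Finset.measurable_fun_sum _ fun k _ => ((hA i k).comp (hT.iterate n)).mul (ih k j)

theorem measurable_minorSumLE {B : Δ → Matrix (Fin p) (Fin p) ℝ}
    (hB : ∀ i j, Measurable fun x => B x i j) (q : ℕ) :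
    Measurable fun x => Matrix.minorSumLE q (B x) := by
  unfold Matrix.minorSumLE Matrix.minorSum
  refine Finset.measurable_fun_sum _ fun j _ => Finset.measurable_fun_sum _ fun f _ =>
    Finset.measurable_fun_sum _ fun g _ => ?_
  simp only [Matrix.det_apply']
  refine Measurable.abs (Finset.measurable_fun_sum _ fun π _ => measurable_const.mul ?_)
  exact Finset.measurable_fun_prod _ fun i _ => hB _ _

theorem IsMeasurableCocycle.measurable_norm (h : IsMeasurableCocycle μ T A) :
    Measurable fun x => ‖euclideanOp (A x)‖ := by
  have h1 : Continuous fun M : Fin p → Fin p → ℝ =>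
      ‖Matrix.toEuclideanCLM (n := Fin p) (𝕜 := ℝ) (Matrix.of M)‖ := by
    let F : (Fin p → Fin p → ℝ) →ₗ[ℝ]
        (EuclideanSpace ℝ (Fin p) →L[ℝ] EuclideanSpace ℝ (Fin p)) :=
      { toFun := fun M => Matrix.toEuclideanCLM (n := Fin p) (𝕜 := ℝ) (Matrix.of M)
        map_add' := fun M N => by rw [← map_add]; rfl
        map_smul' := fun c M => by rw [RingHom.id_apply, ← map_smul]; rfl }
    exact F.continuous_of_finiteDimensional.norm
  have h2 : Measurable fun x => fun i j => (A x : Matrix (Fin p) (Fin p) ℝ) i j :=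
    measurable_pi_lambda _ fun i => measurable_pi_lambda _ fun j => h.measurable i j
  exact h1.measurable.comp h2

theorem IsMeasurableCocycle.integrable_log_max (h : IsMeasurableCocycle μ T A) :
    Integrable (fun x => Real.log (max 1 ‖euclideanOp (A x)‖)) μ := by
  have hm : Measurable fun x => Real.log (max 1 ‖euclideanOp (A x)‖) :=
    Real.measurable_log.comp (measurable_const.max h.measurable_norm)
  refine ⟨hm.aestronglyMeasurable, ?_⟩
  rw [hasFiniteIntegral_iff_ofReal
    (Eventually.of_forall fun x => Real.log_nonneg (le_max_left _ _))]
  refine lt_of_le_of_lt (lintegral_mono fun x => ?_) h.lintegral_log_lt_top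
  rcases le_or_gt 1 ‖euclideanOp (A x)‖ with h1 | h1
  · rw [max_eq_right h1]
  · rw [max_eq_left h1.le]; simp

/-- The sums of minors of the iterates have an exponential growth rate almost everywhere. -/
theorem IsMeasurableCocycle.exists_tendsto_minorSumLE (h : IsMeasurableCocycle μ T A) (q : ℕ) :
    ∃ γ : ℝ, ∀ᵐ x ∂μ, Tendsto (fun n : ℕ => Real.log (Matrix.minorSumLE q
      (cocycleIter T A n x : Matrix (Fin p) (Fin p) ℝ)) / n) atTop (𝓝 γ) := by
  have := h.isProbabilityMeasure
  have hpos : ∀ B : Matrix (Fin p) (Fin p) ℝ, 0 < Matrix.minorSumLE q B := fun B =>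
    zero_lt_one.trans_le (Matrix.one_le_minorSumLE q B)
  have hmeas : ∀ n, Measurable fun x => Real.log (Matrix.minorSumLE q
      (cocycleIter T A n x : Matrix (Fin p) (Fin p) ℝ)) := fun n =>
    Real.measurable_log.comp (measurable_minorSumLE
      (measurable_cocycleIter h.ergodic.measurable h.measurable n) q)
  refine h.ergodic.exists_tendsto_of_subadditive (g := fun n x => Real.log (Matrix.minorSumLE q
      (cocycleIter T A n x : Matrix (Fin p) (Fin p) ℝ))) hmeas
    (fun n x => Real.log_nonneg (Matrix.one_le_minorSumLE _ _)) (fun m n x => ?_) ?_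
  · rw [← Real.log_mul (hpos _).ne' (hpos _).ne', cocycleIter_add, Units.val_mul, mul_comm]
    exact Real.log_le_log (hpos _) (Matrix.minorSumLE_mul_le _ _ _)
  · set D : ℝ := ∑ j ∈ Finset.range (q + 1), (p : ℝ) ^ j * ((p : ℝ) ^ j * j.factorial) with hD
    have hD1 : 1 ≤ D := by
      have := Finset.single_le_sum (f := fun j => (p : ℝ) ^ j * ((p : ℝ) ^ j * j.factorial))
        (fun j _ => by positivity) (Finset.mem_range.2 (Nat.succ_pos q))
      simpa using this
    refine Integrable.mono' ((integrable_const (Real.log D)).add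
      (h.integrable_log_max.const_mul (q : ℝ))) (hmeas 1).aestronglyMeasurable
      (Eventually.of_forall fun x => ?_)
    rw [Real.norm_eq_abs, abs_of_nonneg (Real.log_nonneg (Matrix.one_le_minorSumLE _ _))]
    have h1 := Matrix.minorSumLE_le_of_entry_le q (le_max_left 1 ‖euclideanOp (A x)‖)
      (B := (A x : Matrix (Fin p) (Fin p) ℝ))
      (fun i k => (abs_entry_le_norm_euclideanOp (A x) i k).trans (le_max_right _ _))
    have h2 : cocycleIter T A 1 x = A x := by simp [cocycleIter]
    rw [h2]
    have h3 : 0 < max 1 ‖euclideanOp (A x)‖ := lt_max_of_lt_left one_pos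
    refine (Real.log_le_log (hpos _) h1).trans (le_of_eq ?_)
    rw [Real.log_mul (by positivity) (by positivity), Real.log_pow]
    rfl

/-- Turns rates of products of singular values into rates of single ones, by subtraction. -/
theorem log_initialProd_succ {q : ℕ} (hq : q < p) (σ : Fin p → ℝ) :
    Real.log (max 1 (σ ⟨q, hq⟩)) =
      Real.log (Matrix.initialProd (q + 1) σ) - Real.log (Matrix.initialProd q σ) := by
  have hpos : ∀ i, 0 < max 1 (σ i) := fun i => lt_max_of_lt_left one_pos
  have h1 : Finset.univ.filter (fun i : Fin p => i.val < q + 1) =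
      insert ⟨q, hq⟩ (Finset.univ.filter (fun i : Fin p => i.val < q)) := by
    ext i
    simp only [Finset.mem_filter, Finset.mem_univ, true_and, Finset.mem_insert, Fin.ext_iff]
    omega
  rw [Matrix.initialProd, h1, Finset.prod_insert (by simp),
    Real.log_mul (hpos _).ne' (Finset.prod_pos fun i _ => hpos i).ne', Matrix.initialProd]
  ring

/-- The exponents of the singular values of the iterates, truncated below by `0`, exist almost
everywhere. -/
theorem IsMeasurableCocycle.ae_exists_singularFlow (h : IsMeasurableCocycle μ T A) :
    ∀ᵐ x ∂μ, ∃ e f σ τ, SingularFlow (fun n => euclideanOp (cocycleIter T A n x)) e f σ τ := by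
  have := h.isProbabilityMeasure
  choose γ hγ using h.exists_tendsto_minorSumLE
  -- Sublinear growth of `log⁺ ‖A‖` along the orbit is the subexponential one-step bound of
  -- `SingularFlow`.
  have hstep := h.ergodic.eventually_comp_iterate_le
    (Real.measurable_log.comp (measurable_const.max h.measurable_norm))
    (fun x => Real.log_nonneg (le_max_left 1 ‖euclideanOp (A x)‖)) h.integrable_log_max
  filter_upwards [ae_all_iff.2 hγ, hstep] with x hx hxs
  choose e f σ hσ hpos hB using fun n => exists_singular_bases (cocycleIter T A n x)
  have hQ : ∀ q, Tendsto (fun n : ℕ => Real.log (Matrix.initialProd q (σ n)) / n) atTop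
      (𝓝 (γ q)) := by
    intro q
    obtain ⟨C, hC1, hC⟩ := exists_initialProd_comparable p q
    have hC0 : 0 < C := zero_lt_one.trans_le hC1
    have h0 : Tendsto (fun n : ℕ => Real.log C / n) atTop (𝓝 0) :=
      tendsto_const_div_atTop_nhds_zero_nat _
    have hM : ∀ n, 0 < Matrix.minorSumLE q (cocycleIter T A n x : Matrix (Fin p) (Fin p) ℝ) :=
      fun n => zero_lt_one.trans_le (Matrix.one_le_minorSumLE q _)
    have hP : ∀ n, 0 < Matrix.initialProd q (σ n) := fun n =>
      Finset.prod_pos fun i _ => lt_max_of_lt_left one_pos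
    refine tendsto_of_tendsto_of_tendsto_of_le_of_le (by simpa using (hx q).sub h0)
      (by simpa using (hx q).add h0) (fun n => ?_) (fun n => ?_)
    · obtain ⟨_, h2⟩ := hC _ (e n) (f n) (σ n) (hσ n) (hpos n) (hB n)
      have h3 := Real.log_le_log (hM n) h2
      rw [Real.log_mul hC0.ne' (hP n).ne'] at h3
      simp only [← sub_div]
      gcongr
      linarith
    · obtain ⟨h2, _⟩ := hC _ (e n) (f n) (σ n) (hσ n) (hpos n) (hB n)
      have h3 := Real.log_le_log (hP n) h2
      rw [Real.log_mul hC0.ne' (hM n).ne'] at h3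
      simp only [← add_div]
      gcongr
      linarith
  have hlim : ∀ i : Fin p, Tendsto (fun n : ℕ => Real.log (max 1 (σ n i)) / n) atTop
      (𝓝 (γ (i + 1) - γ i)) := fun i => by
    simp only [log_initialProd_succ i.isLt, sub_div]
    exact (hQ _).sub (hQ _)
  refine ⟨e, f, σ, fun i => γ (i + 1) - γ i, hB, hpos, fun i => ?_, hlim, fun ε hε => ?_⟩
  · exact ge_of_tendsto' (hlim i) fun n =>
      div_nonneg (Real.log_nonneg (le_max_left _ _)) (Nat.cast_nonneg n)
  · filter_upwards [hxs ε hε] with n hn v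
    rw [show cocycleIter T A (n + 1) x = A (T^[n] x) * cocycleIter T A n x from rfl,
      euclideanOp_mul_apply]
    refine ((euclideanOp (A (T^[n] x))).le_opNorm _).trans ?_
    gcongr
    refine (le_max_right 1 _).trans ?_
    rw [← Real.log_le_iff_le_exp (lt_max_of_lt_left one_pos), mul_comm]
    exact hn

/-- Almost everywhere, every subspace transverse to the central stable space is expanded uniformly
at an exponential rate. -/
theorem IsMeasurableCocycle.ae_uniform_growth (h : IsMeasurableCocycle μ T A) :
    ∀ᵐ x ∂μ, ∀ G : Submodule ℝ (EuclideanSpace ℝ (Fin p)),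
      Disjoint G (centralStableSpace T A x) →
      ∃ c : ℝ, 0 < c ∧ ∃ l : ℝ, 0 < l ∧ ∀ᶠ n : ℕ in atTop, ∀ v ∈ G,
        c * Real.exp (n * l) * ‖v‖ ≤ ‖euclideanOp (cocycleIter T A n x) v‖ := by
  filter_upwards [h.ae_exists_singularFlow] with x ⟨e, f, σ, τ, hflow⟩ G hG
  exact hflow.exists_uniform_growth G fun v hv hvε =>
    Submodule.disjoint_def.1 hG v hv (mem_centralStableSpace_of_eventually_le hvε)

end Cocycle

/-! ### Counting lattice itineraries, and a covering criterion for null Hausdorff measure. -/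

/-- The integer vector with given coordinates. -/
def latticePoint {p : ℕ} (z : Fin p → ℤ) : EuclideanSpace ℝ (Fin p) :=
  WithLp.toLp 2 fun i => (z i : ℝ)

theorem exists_latticePoint_of_infDist_lt {p : ℕ} {y : EuclideanSpace ℝ (Fin p)} {δ : ℝ}
    (h : Metric.infDist y (integerLattice p) < δ) : ∃ z : Fin p → ℤ, ‖y - latticePoint z‖ < δ := by
  have hne : (integerLattice p).Nonempty := ⟨0, fun i => ⟨0, by simp⟩⟩
  obtain ⟨v, hv, hd⟩ := (Metric.infDist_lt_iff hne).1 h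
  choose z hz using hv
  refine ⟨z, ?_⟩
  have : v = latticePoint z := by
    ext i
    simp [latticePoint, hz]
  rwa [← this, ← dist_eq_norm]

/-- A ball of radius `r` contains at most `⌈2r⌉ ^ p` integer points. -/
theorem exists_finset_latticePoint {p : ℕ} (a : EuclideanSpace ℝ (Fin p)) (r : ℝ) :
    ∃ F : Finset (Fin p → ℤ), F.card ≤ ⌈2 * r⌉₊ ^ p ∧
      ∀ z : Fin p → ℤ, ‖latticePoint z - a‖ < r → z ∈ F := by
  -- Open intervals matter: they give `⌈2 * r⌉` and not one more, so there is a single choice when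
  -- `0 < r ≤ 1 / 2`. Otherwise the branching would not die out as `δ → 0`.
  refine ⟨Fintype.piFinset fun i => Finset.Ioo ⌊a i - r⌋ ⌈a i + r⌉, ?_, fun z hz => ?_⟩
  · rw [Fintype.card_piFinset]
    calc _ ≤ ∏ _i : Fin p, ⌈2 * r⌉₊ := by
          refine Finset.prod_le_prod' fun i _ => ?_
          rw [Int.card_Ioo]
          have h1 := Int.ceil_lt_add_one (a i + r)
          have h2 := Int.lt_floor_add_one (a i - r)
          have h3 := Nat.le_ceil (2 * r)
          have h4 : ⌈a i + r⌉ - ⌊a i - r⌋ - 1 < (⌈2 * r⌉₊ : ℤ) + 1 := by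
            have : ((⌈a i + r⌉ - ⌊a i - r⌋ - 1 : ℤ) : ℝ) < ((⌈2 * r⌉₊ : ℤ) + 1 : ℤ) := by
              push_cast
              linarith
            exact_mod_cast this
          omega
      _ = _ := by simp
  · rw [Fintype.mem_piFinset]
    intro i
    have h1 := (PiLp.norm_apply_le (latticePoint z - a) i).trans_lt hz
    have h2 : (latticePoint z - a) i = (z i : ℝ) - a i := by simp [latticePoint]
    rw [h2, Real.norm_eq_abs, abs_lt] at h1
    rw [Finset.mem_Ioo]
    constructor
    · rw [Int.floor_lt]; linarith
    · rw [Int.lt_ceil]; linarith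

/-- Points whose orbits under a sequence of linear maps stay `δ`-close to the lattice follow few
lattice itineraries. -/
theorem exists_finset_itineraries {p : ℕ}
    {B : ℕ → EuclideanSpace ℝ (Fin p) →L[ℝ] EuclideanSpace ℝ (Fin p)} {M : ℕ → ℝ} {δ : ℝ}
    (hM1 : ∀ n, 1 ≤ M n) (hM : ∀ n, ‖B n‖ ≤ M n) (hδ : 0 < δ) (z₀ : Fin p → ℤ) (k : ℕ) :
    ∃ F : Finset (Fin p → ℤ), F.card ≤ (∏ i ∈ Finset.range k, ⌈4 * δ * M i⌉₊) ^ p ∧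
      ∀ y : ℕ → EuclideanSpace ℝ (Fin p), (∀ n, y (n + 1) = B n (y n)) →
        (∀ n, Metric.infDist (y n) (integerLattice p) < δ) → ‖y 0 - latticePoint z₀‖ < δ →
        ∃ z ∈ F, ‖y k - latticePoint z‖ < δ := by
  induction k with
  | zero => exact ⟨{z₀}, by simp, fun y _ _ h => ⟨z₀, by simp, h⟩⟩
  | succ k ih =>
    obtain ⟨F, hF, hFy⟩ := ih
    -- The next lattice point is within `δ` of `y (k + 1)`, itself within `M k * δ` of the image of
    -- `z`; as `M k ≥ 1`, the sum is at most `2 * δ * M k`.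
    choose Φ hΦ hΦz using fun z : Fin p → ℤ =>
      exists_finset_latticePoint (B k (latticePoint z)) (2 * δ * M k)
    refine ⟨F.biUnion Φ, ?_, fun y hy hd h0 => ?_⟩
    · refine Finset.card_biUnion_le.trans ?_
      calc ∑ z ∈ F, (Φ z).card ≤ ∑ z ∈ F, ⌈4 * δ * M k⌉₊ ^ p := by
            refine Finset.sum_le_sum fun z _ => ?_
            have := hΦ z
            rwa [show 2 * (2 * δ * M k) = 4 * δ * M k by ring] at this
        _ ≤ _ := by
            rw [Finset.sum_const, smul_eq_mul, Finset.prod_range_succ, mul_pow]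
            gcongr
    · obtain ⟨z, hz, hzy⟩ := hFy y hy hd h0
      obtain ⟨z', hz'⟩ := exists_latticePoint_of_infDist_lt (hd (k + 1))
      refine ⟨z', Finset.mem_biUnion.2 ⟨z, hz, hΦz z z' ?_⟩, hz'⟩
      have h1 : ‖B k (y k - latticePoint z)‖ ≤ M k * δ := by
        refine ((B k).le_opNorm _).trans ?_
        have := hM k
        have := hM1 k
        gcongr
      rw [map_sub, ← hy k] at h1
      have h2 : latticePoint z' - B k (latticePoint z) =
          (y (k + 1) - B k (latticePoint z)) - (y (k + 1) - latticePoint z') := by abel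
      rw [h2]
      have h3 := norm_sub_le (y (k + 1) - B k (latticePoint z)) (y (k + 1) - latticePoint z')
      have := hM1 k
      nlinarith

/-- A set covered by subexponentially many pieces of exponentially small diameter is null for the
Hausdorff measures of positive dimension. -/
theorem hausdorffMeasure_eq_zero_of_covers {X ι : Type*} [MetricSpace X] [MeasurableSpace X]
    [BorelSpace X] {S : Set X} {s C a b : ℝ} (hs : 0 < s) (hb : 0 < b) (hab : a < b * s)
    (hC : 0 ≤ C) (F : ℕ → Finset ι) (t : ℕ → ι → Set X)
    (hcard : ∀ᶠ n in atTop, ((F n).card : ℝ) ≤ Real.exp (n * a))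
    (hdiam : ∀ᶠ n in atTop, ∀ i, ∀ x ∈ t n i, ∀ y ∈ t n i, dist x y ≤ C * Real.exp (-(n * b)))
    (hcov : ∀ᶠ n in atTop, ∀ x ∈ S, ∃ i ∈ F n, x ∈ t n i) : μH[s] S = 0 := by
  have hexp : ∀ c : ℝ, 0 < c → ∀ D : ℝ,
      Tendsto (fun n : ℕ => ENNReal.ofReal (D * Real.exp (-(n * c)))) atTop (𝓝 0) := by
    intro c hc D
    have h1 : Tendsto (fun n : ℕ => D * Real.exp (-(n * c))) atTop (𝓝 (D * 0)) :=
      (Real.tendsto_exp_atBot.comp (tendsto_neg_atTop_atBot.comp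
        (tendsto_natCast_atTop_atTop.atTop_mul_const hc))).const_mul D
    rw [mul_zero] at h1
    simpa using ENNReal.tendsto_ofReal h1
  have hd : ∀ᶠ n in atTop, ∀ i, Metric.ediam (t n i) ≤ ENNReal.ofReal (C * Real.exp (-(n * b))) := by
    filter_upwards [hdiam] with n hn i
    refine Metric.ediam_le fun x hx y hy => ?_
    rw [edist_dist]
    exact ENNReal.ofReal_le_ofReal (hn i x hx y hy)
  have key := Measure.hausdorffMeasure_le_liminf_sum (β := ℕ) (ι := fun n => F n) s S (l := atTop)
    (fun n => ENNReal.ofReal (C * Real.exp (-(n * b)))) (hexp b hb C) (fun n i => t n i)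
    (by filter_upwards [hd] with n hn i using hn i)
    (by
      filter_upwards [hcov] with n hn x hx
      obtain ⟨i, hi, hxi⟩ := hn x hx
      exact Set.mem_iUnion.2 ⟨⟨i, hi⟩, hxi⟩)
  refine le_antisymm (key.trans ?_) zero_le
  have hlim := hexp (b * s - a) (by linarith) (C ^ s)
  rw [← hlim.liminf_eq]
  refine liminf_le_liminf ?_
  filter_upwards [hd, hcard] with n hn hc
  calc ∑ i : F n, Metric.ediam (t n i) ^ s
      ≤ ∑ i : F n, ENNReal.ofReal (C * Real.exp (-(n * b))) ^ s :=
        Finset.sum_le_sum fun i _ => ENNReal.rpow_le_rpow (hn i) hs.le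
    _ = ENNReal.ofReal ((F n).card * (C * Real.exp (-(n * b))) ^ s) := by
        rw [Finset.sum_const, Finset.card_univ, Fintype.card_coe, nsmul_eq_mul,
          ENNReal.ofReal_rpow_of_nonneg (by positivity) hs.le,
          ENNReal.ofReal_mul (Nat.cast_nonneg _), ENNReal.ofReal_natCast]
    _ ≤ _ := by
        refine ENNReal.ofReal_le_ofReal ?_
        rw [Real.mul_rpow hC (Real.exp_pos _).le, ← Real.exp_mul]
        calc _ ≤ Real.exp (n * a) * (C ^ s * Real.exp (-(n * b) * s)) := by gcongr
          _ = _ := by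
            rw [mul_left_comm, ← Real.exp_add]
            congr 2
            ring

/-! ### Branching rate against expansion. -/

section Cocycle

variable {p : ℕ} {Δ : Type*} {T : Δ → Δ} {A : Δ → GL (Fin p) ℝ}

/-- The logarithm of the number of possible continuations of a lattice itinerary. -/
noncomputable def branchingRate (A : Δ → GL (Fin p) ℝ) (j : ℕ) (x : Δ) : ℝ :=
  p * Real.log ⌈max 1 ‖euclideanOp (A x)‖ / ((j : ℝ) + 1)⌉₊

theorem one_le_ceil_div {M : ℝ} (hM : 1 ≤ M) (j : ℕ) : 1 ≤ ⌈M / ((j : ℝ) + 1)⌉₊ :=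
  Nat.one_le_ceil_iff.2 (by positivity)

theorem branchingRate_nonneg (j : ℕ) (x : Δ) : 0 ≤ branchingRate A j x :=
  mul_nonneg (Nat.cast_nonneg _) (Real.log_nonneg (by
    exact_mod_cast one_le_ceil_div (le_max_left 1 ‖euclideanOp (A x)‖) j))

theorem branchingRate_le (j : ℕ) (x : Δ) : branchingRate A j x ≤
    p * (Real.log 2 + Real.log (max 1 ‖euclideanOp (A x)‖)) := by
  have hM : 1 ≤ max 1 ‖euclideanOp (A x)‖ := le_max_left _ _
  unfold branchingRate
  set M := max 1 ‖euclideanOp (A x)‖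
  rw [← Real.log_mul (by norm_num) (by positivity)]
  gcongr
  · have h1 : M / ((j : ℝ) + 1) ≤ M := div_le_self (by positivity) (by simp)
    have h2 := Nat.ceil_lt_add_one (a := M / ((j : ℝ) + 1)) (by positivity)
    linarith

theorem norm_branchingRate_le (j : ℕ) (x : Δ) : ‖branchingRate A j x‖ ≤
    p * (Real.log 2 + Real.log (max 1 ‖euclideanOp (A x)‖)) := by
  rw [Real.norm_eq_abs, abs_of_nonneg (branchingRate_nonneg j x)]
  exact branchingRate_le j x

/-- Uniform growth and a small branching rate make the intersection null. -/
theorem hausdorffMeasure_inter_weakStableSpace_eq_zero {x : Δ}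
    {G₀ : Submodule ℝ (EuclideanSpace ℝ (Fin p))} {G : AffineSubspace ℝ (EuclideanSpace ℝ (Fin p))}
    (hG : G.direction = G₀) {c l s a : ℝ} (hc : 0 < c) (hl : 0 < l) (hs : 0 < s) (ha : a < l * s)
    (hgrow : ∀ᶠ n : ℕ in atTop, ∀ v ∈ G₀,
      c * Real.exp (n * l) * ‖v‖ ≤ ‖euclideanOp (cocycleIter T A n x) v‖) {j : ℕ}
    (hbranch : ∀ᶠ n : ℕ in atTop, birkhoffSum T (branchingRate A j) n x ≤ a * n) :
    μH[s] ((G : Set (EuclideanSpace ℝ (Fin p))) ∩ weakStableSpace T A x) = 0 := by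
  -- Chosen so that `4 * δ * M` is the quotient inside the ceiling of `branchingRate`.
  set δ : ℝ := 1 / (4 * ((j : ℝ) + 1)) with hδ
  have hδ0 : 0 < δ := by positivity
  set y : ℕ → EuclideanSpace ℝ (Fin p) → EuclideanSpace ℝ (Fin p) :=
    fun n w => euclideanOp (cocycleIter T A n x) w with hy
  -- Countably many pieces, indexed by the time from which the orbit is `δ`-close to the lattice and
  -- the lattice point it is near at that time.
  set S : ℕ × (Fin p → ℤ) → Set (EuclideanSpace ℝ (Fin p)) := fun q =>
    {w | w ∈ G ∧ (∀ n ≥ q.1, Metric.infDist (y n w) (integerLattice p) < δ) ∧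
      ‖y q.1 w - latticePoint q.2‖ < δ} with hS
  have hsub : (G : Set (EuclideanSpace ℝ (Fin p))) ∩ weakStableSpace T A x ⊆ ⋃ q, S q := by
    rintro w ⟨hwG, hw⟩
    obtain ⟨N, hN⟩ := eventually_atTop.1
      ((show Tendsto _ _ _ from hw).eventually (gt_mem_nhds hδ0))
    obtain ⟨z, hz⟩ := exists_latticePoint_of_infDist_lt (hN N le_rfl)
    exact Set.mem_iUnion.2 ⟨(N, z), hwG, hN, hz⟩
  refine measure_mono_null hsub (measure_iUnion_null fun q => ?_)
  obtain ⟨N, z₀⟩ := q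
  set M : ℕ → ℝ := fun k => max 1 ‖euclideanOp (A (T^[k] x))‖ with hM
  choose F hFcard hF using fun k => exists_finset_itineraries
    (B := fun k => euclideanOp (A (T^[N + k] x))) (M := fun k => M (N + k))
    (fun _ => le_max_left _ _) (fun _ => le_max_right _ _) hδ0 z₀ k
  have hceil : ∀ k, 1 ≤ ⌈4 * δ * M k⌉₊ := fun k =>
    Nat.one_le_ceil_iff.2 (mul_pos (by positivity) (lt_max_of_lt_left one_pos))
  have hsum : ∀ n, Real.exp (birkhoffSum T (branchingRate A j) n x) =
      ((∏ i ∈ Finset.range n, ⌈4 * δ * M i⌉₊ : ℕ) : ℝ) ^ p := by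
    intro n
    rw [birkhoffSum, Real.exp_sum, Nat.cast_prod, ← Finset.prod_pow]
    refine Finset.prod_congr rfl fun i _ => ?_
    have h1 : max 1 ‖euclideanOp (A (T^[i] x))‖ / ((j : ℝ) + 1) = 4 * δ * M i := by
      rw [hδ, hM]; field_simp
    have h2 : (0 : ℝ) < ⌈4 * δ * M i⌉₊ := by exact_mod_cast hceil i
    rw [branchingRate, h1, Real.exp_nat_mul, Real.exp_log h2]
  refine hausdorffMeasure_eq_zero_of_covers hs hl ha (C := 2 * δ / c) (by positivity)
    (fun n => F (n - N)) (fun n z => {w | w ∈ S (N, z₀) ∧ ‖y n w - latticePoint z‖ < δ}) ?_ ?_ ?_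
  · filter_upwards [hbranch, eventually_ge_atTop N] with n hn hnN
    -- The count starts at time `N`, but the first `N` factors are at least `1`, so the full
    -- Birkhoff sum still bounds it.
    have h1 : ∏ i ∈ Finset.range (n - N), ⌈4 * δ * M (N + i)⌉₊ ≤
        ∏ i ∈ Finset.range n, ⌈4 * δ * M i⌉₊ := by
      have h2 := Finset.prod_range_add (fun i => ⌈4 * δ * M i⌉₊) N (n - N)
      rw [Nat.add_sub_cancel' hnN] at h2
      rw [h2]
      exact Nat.le_mul_of_pos_left _ (Finset.prod_pos fun i _ => hceil i)
    calc ((F (n - N)).card : ℝ)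
        ≤ ((∏ i ∈ Finset.range n, ⌈4 * δ * M i⌉₊ : ℕ) : ℝ) ^ p := by
          exact_mod_cast (hFcard (n - N)).trans (Nat.pow_le_pow_left h1 p)
      _ ≤ Real.exp (n * a) := by
          rw [← hsum]
          exact Real.exp_le_exp.2 (by linarith)
  · filter_upwards [hgrow] with n hn z w hw w' hw'
    have h1 : w - w' ∈ G₀ := by
      rw [← hG]
      exact AffineSubspace.vsub_mem_direction hw.1.1 hw'.1.1
    have h2 := hn _ h1
    have h3 : ‖euclideanOp (cocycleIter T A n x) (w - w')‖ ≤ 2 * δ := by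
      rw [map_sub]
      have h4 : y n w - y n w' = (y n w - latticePoint z) - (y n w' - latticePoint z) := by abel
      change ‖y n w - y n w'‖ ≤ _
      rw [h4]
      refine (norm_sub_le _ _).trans ?_
      linarith [hw.2, hw'.2]
    rw [dist_eq_norm, Real.exp_neg, div_mul_eq_mul_div, le_div_iff₀ hc,
      ← div_eq_mul_inv, le_div_iff₀ (Real.exp_pos _)]
    linarith
  · filter_upwards [eventually_ge_atTop N] with n hnN w hw
    obtain ⟨z, hz, hzy⟩ := hF (n - N) (fun k => y (N + k) w)
      (fun k => by
        rw [hy]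
        change euclideanOp (A (T^[N + k] x) * cocycleIter T A (N + k) x) w = _
        rw [euclideanOp_mul_apply])
      (fun k => hw.2.1 (N + k) (by omega)) hw.2.2
    rw [Nat.add_sub_cancel' hnN] at hzy
    exact ⟨z, hz, hw, hzy⟩

variable [MeasurableSpace Δ] {μ : Measure Δ}

theorem IsMeasurableCocycle.measurable_branchingRate (h : IsMeasurableCocycle μ T A) (j : ℕ) :
    Measurable (branchingRate A j) := by
  refine measurable_const.mul (Real.measurable_log.comp ?_)
  exact measurable_from_nat.comp
    (Nat.measurable_ceil.comp ((measurable_const.max h.measurable_norm).div_const _))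

theorem IsMeasurableCocycle.integrable_branchingRate_bound (h : IsMeasurableCocycle μ T A) :
    Integrable (fun x => p * (Real.log 2 + Real.log (max 1 ‖euclideanOp (A x)‖))) μ := by
  have := h.isProbabilityMeasure
  exact ((integrable_const _).add h.integrable_log_max).const_mul _

/-- For fixed `x` the ceiling is `1` once `j` exceeds `max 1 ‖A(x)‖`, so the rate vanishes; the
bound by `log⁺ ‖A‖` is uniform in `j`, and dominated convergence applies. -/
theorem IsMeasurableCocycle.tendsto_integral_branchingRate (h : IsMeasurableCocycle μ T A) :
    Tendsto (fun j => ∫ x, branchingRate A j x ∂μ) atTop (𝓝 0) := by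
  have := tendsto_integral_of_dominated_convergence
    (F := fun j x => branchingRate A j x) (f := fun _ => (0 : ℝ)) _
    (fun j => (h.measurable_branchingRate j).aestronglyMeasurable)
    h.integrable_branchingRate_bound
    (fun j => Eventually.of_forall (norm_branchingRate_le j))
    (Eventually.of_forall fun x => by
      refine tendsto_const_nhds.congr' ?_
      obtain ⟨j0, hj0⟩ := exists_nat_ge (max 1 ‖euclideanOp (A x)‖)
      filter_upwards [eventually_ge_atTop j0] with j hj
      have hj' : (j0 : ℝ) ≤ j := by exact_mod_cast hj
      have h1 : ⌈max 1 ‖euclideanOp (A x)‖ / ((j : ℝ) + 1)⌉₊ = 1 := by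
        refine le_antisymm (Nat.ceil_le.2 ?_) (one_le_ceil_div (le_max_left _ _) j)
        rw [Nat.cast_one, div_le_one (by positivity)]
        linarith
      rw [branchingRate, h1]
      simp)
  simpa using this

end Cocycle

/-- For almost every `x`, every affine subspace `G` parallel to a linear subspace `G₀` with
`G₀ ∩ E^{cs}(x) = {0}` meets `W^s(x)` in a set of Hausdorff dimension `0`. -/
theorem mainTheorem10 {Δ : Type*} [MeasurableSpace Δ] (μ : Measure Δ) (p : ℕ)
    (T : Δ → Δ) (A : Δ → GL (Fin p) ℝ) (hTA : IsMeasurableCocycle μ T A) :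
    ∀ᵐ x ∂μ, ∀ G₀ : Submodule ℝ (EuclideanSpace ℝ (Fin p)),
      Disjoint G₀ (centralStableSpace T A x) →
      ∀ G : AffineSubspace ℝ (EuclideanSpace ℝ (Fin p)),
        AffineSubspace.Parallel G G₀.toAffineSubspace →
        dimH ((G : Set (EuclideanSpace ℝ (Fin p))) ∩ weakStableSpace T A x) = 0 := by
  have := hTA.isProbabilityMeasure
  have hbr : ∀ j : ℕ, ∀ᵐ x ∂μ, ∀ᶠ n : ℕ in atTop, birkhoffSum T (branchingRate A j) n x ≤
      (∫ x, branchingRate A j x ∂μ + 1 / ((j : ℝ) + 1)) * n := fun j =>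
    hTA.ergodic.eventually_birkhoffSum_le (hTA.measurable_branchingRate j)
      (branchingRate_nonneg j)
      (hTA.integrable_branchingRate_bound.mono' (hTA.measurable_branchingRate j).aestronglyMeasurable
        (Eventually.of_forall (norm_branchingRate_le j)))
      (lt_add_of_pos_right _ (by positivity))
  filter_upwards [hTA.ae_uniform_growth, ae_all_iff.2 hbr] with x hgrow hx G₀ hG₀ G hG
  obtain ⟨c, hc, l, hl, hcl⟩ := hgrow G₀ hG₀
  have hdir : G.direction = G₀ := by
    rw [hG.direction_eq, Submodule.toAffineSubspace_direction]
  have hlim : Tendsto (fun j : ℕ => ∫ x, branchingRate A j x ∂μ + 1 / ((j : ℝ) + 1)) atTop (𝓝 0) := by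
    simpa using hTA.tendsto_integral_branchingRate.add
      (tendsto_one_div_add_atTop_nhds_zero_nat (𝕜 := ℝ))
  refine le_antisymm (le_of_forall_gt fun s hs => ?_) zero_le
  obtain ⟨r, hr0, hrs⟩ := ENNReal.lt_iff_exists_nnreal_btwn.1 hs
  have hr : (0 : ℝ) < r := by exact_mod_cast hr0
  -- The rate `l` depends only on `x` and `G₀` and is fixed before `j`, so the branching can be made
  -- smaller than `l * r` for any `r > 0`.
  obtain ⟨j, hj⟩ := (hlim.eventually (gt_mem_nhds (mul_pos hl hr))).exists
  have hzero := hausdorffMeasure_inter_weakStableSpace_eq_zero hdir hc hl hr hj hcl (hx j)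
  exact (dimH_le_of_hausdorffMeasure_ne_top (by rw [hzero]; exact ENNReal.zero_ne_top)).trans_lt hrs
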